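/- Let $k$ be an algebraically closed field of characteristic zero, $G$ a finite group and $H\subset G$ a subgroup. Let ${\cal Z}(G)$ be the $k$-linear ribbon category of finite-dimensional $G$-graded vector spaces $X=\bigoplus_{g\in G}X_g$ with a $G$-action satisfying $f(X_g)=X_{fgf^{-1}}$; morphisms are the linear maps preserving grading and action, the tensor product is that of graded vector spaces with the diagonal action $f(x\otimes y)=f(x)\otimes f(y)$, the unit is $k$ in degree $e$ with trivial action, the braiding is $c_{X,Y}(x\otimes y)=f(y)\otimes x$ and the twist is $\theta_X(x)=f^{-1}(x)$ for $x\in X_f$, $y\in Y$. (In a ribbon category the twist is normalised here by $\theta_X\otimes\theta_Y=\theta_{X\otimes Y}\circ c_{Y,X}\circ c_{X,Y}$, and it is self-dual, $\theta_{X^\vee}=(\theta_X)^\vee$.) Let $A=k(G/H)$ be the algebra of $k$-valued functions on $G/H$, with basis the minimal idempotents $p_x$, $x\in G/H$ (the delta functions), placed in degree $e$, with $G$-action $f(p_x)=p_{fx}$. It is a commutative algebra in ${\cal Z}(G)$, and it is separable: there is a morphism $\epsilon:A\to 1$ for which $\epsilon\mu:A\otimes A\to 1$ is a non-degenerate pairing.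 A right $A$-module $(M,\nu:M\otimes A\to M)$ in ${\cal Z}(G)$ is local if $\nu\, c_{A,M}\,c_{M,A}=\nu$. Let ${\cal Z}(G)^{loc}_{A}$ be the category of local right $A$-modules and module homomorphisms, with tensor product $M\otimes_A N$ (the coequalizer of the two maps $M\otimes A\otimes N\rightrightarrows M\otimes N$ given by the action on $M$ and by the action on $N$ preceded by $c_{A,N}$), unit object $A$, and the braiding induced by that of ${\cal Z}(G)$. Then ${\cal Z}(G)^{loc}_{A}$ is a ribbon category (in particular rigid) whose twist is that of the underlying objects of ${\cal Z}(G)$, and it is equivalent, as a $k$-linear ribbon category, to ${\cal Z}(H)$. More precisely, let $p=p_{H}\in A$ be the minimal idempotent supported at the coset $H$, whose stabilizer in $G$ is $H$. The functor $${\cal Z}(G)^{loc}_{k(G/H)}\to{\cal Z}(H),\qquad M\mapsto Mp,$$ with the grading and the $H$-action restricted from $M$, admits the structure of a $k$-linear braided monoidal equivalence preserving the twists. As an equivalence of categories it has the quasi-inverse $U\mapsto k(G)\otimes_H U$. Here $k(G)\otimes_H U$ is spanned by the elements $p_g\otimes u$ ($g\in G$, $u\in U$), linear in $u$, modulo the relations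 $p_{gh}\otimes u=p_g\otimes h(u)$ for $h\in H$, with $G$-grading $|p_g\otimes u|=g|u|g^{-1}$ for homogeneous $u$, $G$-action $f(p_g\otimes u)=p_{fg}\otimes u$ and $A$-action $(p_g\otimes u)p_x=p_g\otimes u$ if $g\in x$ and $0$ otherwise. -/

import Mathlib

open CategoryTheory MonoidalCategory Limits
open scoped MonObj

universe v₁ u₁ u

set_option linter.unusedSectionVars false

namespace LocalModules

section Modules

variable {C : Type u₁} [Category.{v₁} C] [MonoidalCategory C]

/-- Right modules over an algebra `A` in a monoidal category. -/
structure RMod (A : C) [MonObj A] where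
  X : C
  act : X ⊗ A ⟶ X
  act_one : X ◁ η ≫ act = (ρ_ X).hom
  act_mul : X ◁ μ ≫ act = (α_ X A A).inv ≫ act ▷ A ≫ act

namespace RMod

variable {A : C} [MonObj A]

/-- Homomorphisms of right modules. -/
@[ext]
structure Hom (M N : RMod A) where
  hom : M.X ⟶ N.X
  act_hom : M.act ≫ hom = hom ▷ A ≫ N.act

instance : Category (RMod A) where
  Hom M N := Hom M N
  id M := ⟨𝟙 M.X, by simp⟩
  comp f g := ⟨f.hom ≫ g.hom, by
    rw [← Category.assoc, f.act_hom, Category.assoc, g.act_hom, comp_whiskerRight,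
      Category.assoc]⟩

@[ext]
theorem hom_ext {M N : RMod A} (f g : M ⟶ N) (h : f.hom = g.hom) : f = g := Hom.ext h

@[simp] theorem id_hom (M : RMod A) : Hom.hom (𝟙 M) = 𝟙 M.X := rfl

@[simp] theorem comp_hom {M N P : RMod A} (f : M ⟶ N) (g : N ⟶ P) :
    (f ≫ g).hom = f.hom ≫ g.hom := rfl

/-- An isomorphism of right modules from an isomorphism of underlying objects. -/
@[simps]
def isoMk {M N : RMod A} (e : M.X ≅ N.X) (h : M.act ≫ e.hom = e.hom ▷ A ≫ N.act) : M ≅ N where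
  hom := ⟨e.hom, h⟩
  inv := ⟨e.inv, by
    rw [Iso.comp_inv_eq, Category.assoc, h, ← comp_whiskerRight_assoc, e.inv_hom_id,
      id_whiskerRight, Category.id_comp]⟩

variable [Preadditive C] [MonoidalPreadditive C]

instance (M N : RMod A) : Add (M ⟶ N) where
  add f g := ⟨f.hom + g.hom, by
    rw [Preadditive.comp_add, f.act_hom, g.act_hom, MonoidalPreadditive.add_whiskerRight,
      Preadditive.add_comp]⟩

instance (M N : RMod A) : Zero (M ⟶ N) where
  zero := ⟨0, by simp⟩

instance (M N : RMod A) : Neg (M ⟶ N) where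
  neg f := ⟨-f.hom, by
    have : (-f.hom) ▷ A = -(f.hom ▷ A) := (tensorRight A).map_neg (f := f.hom)
    rw [this, Preadditive.comp_neg, f.act_hom, Preadditive.neg_comp]⟩

instance (M N : RMod A) : AddCommGroup (M ⟶ N) where
  add_assoc f g h := hom_ext _ _ (add_assoc f.hom g.hom h.hom)
  zero_add f := hom_ext _ _ (zero_add f.hom)
  add_zero f := hom_ext _ _ (add_zero f.hom)
  neg_add_cancel f := hom_ext _ _ (neg_add_cancel f.hom)
  add_comm f g := hom_ext _ _ (add_comm f.hom g.hom)
  nsmul := nsmulRec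
  zsmul := zsmulRec

@[simp] theorem add_hom {M N : RMod A} (f g : M ⟶ N) : (f + g).hom = f.hom + g.hom := rfl

instance : Preadditive (RMod A) where
  add_comp _ _ _ f g h := hom_ext _ _ (Preadditive.add_comp _ _ _ f.hom g.hom h.hom)
  comp_add _ _ _ f g h := hom_ext _ _ (Preadditive.comp_add _ _ _ f.hom g.hom h.hom)

variable (k : Type*) [Field k] [Linear k C] [MonoidalLinear k C]

instance (M N : RMod A) : Module k (M ⟶ N) where
  smul r f := ⟨r • f.hom, by
    rw [Linear.comp_smul, f.act_hom, MonoidalLinear.smul_whiskerRight, Linear.smul_comp]⟩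
  one_smul f := hom_ext _ _ (one_smul k f.hom)
  mul_smul r s f := hom_ext _ _ (mul_smul r s f.hom)
  smul_zero r := hom_ext _ _ (smul_zero (A := M.X ⟶ N.X) r)
  smul_add r f g := hom_ext _ _ (smul_add r f.hom g.hom)
  add_smul r s f := hom_ext _ _ (add_smul r s f.hom)
  zero_smul f := hom_ext _ _ (zero_smul k f.hom)

instance : Linear k (RMod A) where
  smul_comp _ _ _ r f g := hom_ext _ _ (Linear.smul_comp _ _ _ r f.hom g.hom)
  comp_smul _ _ _ f r g := hom_ext _ _ (Linear.comp_smul _ _ _ f.hom r g.hom)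

end RMod

end Modules

section Braided

variable {C : Type u₁} [Category.{v₁} C] [MonoidalCategory C] [BraidedCategory C]

namespace RMod

variable {A : C} [MonObj A] [IsCommMonObj A]

theorem act_act (M : RMod A) : M.act ▷ A ≫ M.act = (α_ M.X A A).hom ≫ M.X ◁ μ ≫ M.act := by
  rw [M.act_mul, Iso.hom_inv_id_assoc]

theorem braid_mul (M : C) : (M ◁ (β_ A A).hom) ≫ M ◁ μ[A] = M ◁ μ[A] := by
  rw [← whiskerLeft_comp, IsCommMonObj.mul_comm]

/-- A right module over a commutative algebra as a bimodule: the left action is the right action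
precomposed with the braiding. -/
@[simps]
def toBimod (M : RMod A) : Bimod (Mon.mk A) (Mon.mk A) where
  X := M.X
  actLeft := (β_ A M.X).hom ≫ M.act
  actRight := M.act
  one_actLeft := by
    have := BraidedCategory.braiding_naturality_left η[A] M.X
    rw [reassoc_of% this, M.act_one]
    simp
  left_assoc := by
    have h1 := BraidedCategory.braiding_naturality_left μ[A] M.X
    have h2 := BraidedCategory.braiding_naturality_right A M.act
    have h3 := braid_mul (A := A) M.X
    dsimp only
    simp only [whiskerLeft_comp, Category.assoc]
    rw [reassoc_of% h1, reassoc_of% h2, act_act]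
    simp only [BraidedCategory.braiding_tensor_left_hom,
      BraidedCategory.braiding_tensor_right_hom, Category.assoc, Iso.inv_hom_id_assoc]
    rw [reassoc_of% h3]
  actRight_one := M.act_one
  right_assoc := M.act_mul
  middle_assoc := by
    have h2 := BraidedCategory.braiding_naturality_right A M.act
    have h3 := braid_mul (A := A) M.X
    dsimp only
    simp only [comp_whiskerRight, Category.assoc]
    rw [reassoc_of% h2, act_act]
    simp only [BraidedCategory.braiding_tensor_right_hom, Category.assoc, Iso.inv_hom_id_assoc,
      Iso.hom_inv_id_assoc]
    rw [reassoc_of% h3]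

variable [HasCoequalizers C]

/-- The tensor product `M ⊗[A] N` of right modules: the coequalizer of the two maps
`M ⊗ A ⊗ N ⟶ M ⊗ N`. -/
noncomputable def tensorX (M N : RMod A) : C :=
  coequalizer (M.act ▷ N.X) ((α_ M.X A N.X).hom ≫ M.X ◁ ((β_ A N.X).hom ≫ N.act))

/-- The projection `M ⊗ N ⟶ M ⊗[A] N`. -/
noncomputable def π (M N : RMod A) : M.X ⊗ N.X ⟶ tensorX M N :=
  coequalizer.π (M.act ▷ N.X) ((α_ M.X A N.X).hom ≫ M.X ◁ ((β_ A N.X).hom ≫ N.act))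

/-- The universal property of the tensor product of modules. -/
noncomputable def desc {M N : RMod A} {Z : C} (f : M.X ⊗ N.X ⟶ Z)
    (h : M.act ▷ N.X ≫ f = ((α_ M.X A N.X).hom ≫ M.X ◁ ((β_ A N.X).hom ≫ N.act)) ≫ f) :
    tensorX M N ⟶ Z :=
  coequalizer.desc f h

theorem π_desc {M N : RMod A} {Z : C} (f : M.X ⊗ N.X ⟶ Z)
    (h : M.act ▷ N.X ≫ f = ((α_ M.X A N.X).hom ≫ M.X ◁ ((β_ A N.X).hom ≫ N.act)) ≫ f) :
    π M N ≫ desc f h = f :=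
  coequalizer.π_desc f h

instance (M N : RMod A) : Epi (π M N) := coequalizer.π_epi

theorem π_condition (M N : RMod A) :
    M.act ▷ N.X ≫ π M N = (α_ M.X A N.X).hom ≫ M.X ◁ ((β_ A N.X).hom ≫ N.act) ≫ π M N := by
  have := coequalizer.condition (M.act ▷ N.X)
    ((α_ M.X A N.X).hom ≫ M.X ◁ ((β_ A N.X).hom ≫ N.act))
  rw [Category.assoc] at this
  exact this

variable [∀ X : C, PreservesColimitsOfSize.{0, 0} (tensorLeft X)]
variable [∀ X : C, PreservesColimitsOfSize.{0, 0} (tensorRight X)]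

instance epi_whiskerRight_π (M N : RMod A) (X : C) : Epi (π M N ▷ X) :=
  inferInstanceAs (Epi ((tensorRight X).map
    (coequalizer.π (M.act ▷ N.X) ((α_ M.X A N.X).hom ≫ M.X ◁ ((β_ A N.X).hom ≫ N.act)))))

instance epi_whiskerLeft_π (M N : RMod A) (X : C) : Epi (X ◁ π M N) :=
  inferInstanceAs (Epi ((tensorLeft X).map
    (coequalizer.π (M.act ▷ N.X) ((α_ M.X A N.X).hom ≫ M.X ◁ ((β_ A N.X).hom ≫ N.act)))))

/-- The action on the tensor product of modules is through the action on the second factor. -/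
noncomputable def tensorAct (M N : RMod A) : tensorX M N ⊗ A ⟶ tensorX M N :=
  Bimod.TensorBimod.actRight M.toBimod N.toBimod

theorem π_act (M N : RMod A) : π M N ▷ A ≫ tensorAct M N =
    (α_ M.X N.X A).hom ≫ M.X ◁ N.act ≫ π M N :=
  Bimod.TensorBimod.π_tensor_id_actRight M.toBimod N.toBimod

noncomputable def tensorActLeft (M N : RMod A) : A ⊗ tensorX M N ⟶ tensorX M N :=
  Bimod.TensorBimod.actLeft M.toBimod N.toBimod

theorem π_actLeft (M N : RMod A) : A ◁ π M N ≫ tensorActLeft M N =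
    (α_ A M.X N.X).inv ≫ ((β_ A M.X).hom ≫ M.act) ▷ N.X ≫ π M N :=
  Bimod.TensorBimod.whiskerLeft_π_actLeft M.toBimod N.toBimod

/-- The left action on a tensor product of bimodules is the braided right action. -/
theorem actLeft_eq (M N : RMod A) : tensorActLeft M N =
    (β_ A (tensorX M N)).hom ≫ tensorAct M N := by
  rw [← cancel_epi (A ◁ π M N), π_actLeft]
  have h := BraidedCategory.braiding_naturality_right A (π M N)
  rw [reassoc_of% h, π_act, comp_whiskerRight, Category.assoc, π_condition]
  simp

/-- Tensor product of right modules over a commutative algebra. -/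
noncomputable def tensor (M N : RMod A) : RMod A where
  X := tensorX M N
  act := tensorAct M N
  act_one := Bimod.TensorBimod.actRight_one' M.toBimod N.toBimod
  act_mul := Bimod.TensorBimod.right_assoc' M.toBimod N.toBimod

/-- The regular module. -/
def unit : RMod A where
  X := A
  act := μ
  act_one := by simp
  act_mul := by simp

noncomputable def tensorIso (M N : RMod A) :
    M.toBimod.tensorBimod N.toBimod ≅ (tensor M N).toBimod :=
  Bimod.isoOfIso (Iso.refl _)
    (by
      refine (Category.comp_id _).trans (Eq.trans ?_
        (congrArg (· ≫ _) ((tensorLeft A).map_id (tensorX M N))).symm)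
      exact (actLeft_eq M N).trans (Category.id_comp _).symm)
    (by
      refine (Category.comp_id _).trans (Eq.trans ?_
        (congrArg (· ≫ _) ((tensorRight A).map_id (tensorX M N))).symm)
      exact (Category.id_comp (tensorAct M N)).symm)

noncomputable def unitIso : Bimod.regular (Mon.mk A) ≅ (unit (A := A)).toBimod :=
  Bimod.isoOfIso (Iso.refl _)
    (by
      refine (Category.comp_id _).trans (Eq.trans ?_
        (congrArg (· ≫ _) ((tensorLeft A).map_id A)).symm)
      exact (IsCommMonObj.mul_comm A).symm.trans (Category.id_comp _).symm)
    (by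
      refine (Category.comp_id _).trans (Eq.trans ?_
        (congrArg (· ≫ _) ((tensorRight A).map_id A)).symm)
      exact (Category.id_comp μ[A]).symm)

/-- The embedding of right modules into bimodules. -/
@[simps]
def toBimodFunctor : RMod A ⥤ Bimod (Mon.mk A) (Mon.mk A) where
  obj := toBimod
  map {M N} f :=
    { hom := f.hom
      left_act_hom := by
        have h := BraidedCategory.braiding_naturality_right A f.hom
        have h' : ((β_ A M.X).hom ≫ M.act) ≫ f.hom = A ◁ f.hom ≫ (β_ A N.X).hom ≫ N.act := by
          rw [Category.assoc, f.act_hom, reassoc_of% h]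
        exact h'
      right_act_hom := f.act_hom }

instance : (toBimodFunctor (A := A)).Faithful where
  map_injective h := hom_ext _ _ (congrArg Bimod.Hom.hom h)

/-- A homomorphism of right modules from one of bimodules. -/
def homOfBimod {M N : RMod A} (f : M.toBimod ⟶ N.toBimod) : M ⟶ N := ⟨f.hom, f.right_act_hom⟩

/-- An isomorphism of right modules from one of bimodules. -/
def isoOfBimod {M N : RMod A} (f : M.toBimod ≅ N.toBimod) : M ≅ N where
  hom := homOfBimod f.hom
  inv := homOfBimod f.inv
  hom_inv_id := hom_ext _ _ (congrArg Bimod.Hom.hom f.hom_inv_id)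
  inv_hom_id := hom_ext _ _ (congrArg Bimod.Hom.hom f.inv_hom_id)

attribute [local instance] Bimod.monBicategory

noncomputable instance bimodMonoidal : MonoidalCategory (Bimod (Mon.mk A) (Mon.mk A)) :=
  inferInstanceAs (MonoidalCategory (EndMonoidal (Mon.mk A)))

noncomputable instance : MonoidalCategoryStruct (RMod A) where
  tensorObj := tensor
  whiskerLeft M _ _ f := homOfBimod ((tensorIso M _).inv ≫
    (M.toBimod ◁ toBimodFunctor.map f) ≫ (tensorIso M _).hom)
  whiskerRight f N := homOfBimod ((tensorIso _ N).inv ≫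
    (toBimodFunctor.map f ▷ N.toBimod) ≫ (tensorIso _ N).hom)
  tensorHom f g := homOfBimod ((tensorIso _ _).inv ≫
    (toBimodFunctor.map f ⊗ₘ toBimodFunctor.map g) ≫ (tensorIso _ _).hom)
  tensorUnit := unit
  associator L M N := isoOfBimod
    (((tensorIso _ _).symm ≪≫ ((tensorIso _ _).symm ⊗ᵢ .refl _))
        ≪≫ α_ L.toBimod M.toBimod N.toBimod
        ≪≫ ((.refl _ ⊗ᵢ tensorIso _ _) ≪≫ tensorIso _ _))
  leftUnitor M := isoOfBimod
    (((tensorIso _ _).symm ≪≫ (unitIso.symm ⊗ᵢ .refl _)) ≪≫ λ_ M.toBimod)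
  rightUnitor M := isoOfBimod
    (((tensorIso _ _).symm ≪≫ (.refl _ ⊗ᵢ unitIso.symm)) ≪≫ ρ_ M.toBimod)

/-- The category of modules over a commutative algebra is monoidal. -/
noncomputable instance : MonoidalCategory (RMod A) :=
  Monoidal.induced toBimodFunctor
    { μIso := tensorIso
      εIso := unitIso
      whiskerLeft_eq := fun _ _ _ _ => rfl
      whiskerRight_eq := fun _ _ => rfl
      tensorHom_eq := fun _ _ => rfl
      associator_eq := fun _ _ _ => rfl
      leftUnitor_eq := fun _ => rfl
      rightUnitor_eq := fun _ => rfl }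

/-- A right module is local if the double braiding with the algebra does not change the action. -/
def IsLocal : ObjectProperty (RMod A) := fun M =>
  (β_ M.X A).hom ≫ (β_ A M.X).hom ≫ M.act = M.act

theorem tensor_isLocal {M N : RMod A} (hM : IsLocal M) (hN : IsLocal N) :
    IsLocal (tensor M N) := by
  change (β_ (tensorX M N) A).hom ≫ (β_ A (tensorX M N)).hom ≫ tensorAct M N = tensorAct M N
  change _ = _ at hM
  change _ = _ at hN
  rw [← cancel_epi (π M N ▷ A)]
  have h1 := BraidedCategory.braiding_naturality_left (π M N) A
  have h2 := BraidedCategory.braiding_naturality_right A (π M N)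
  rw [reassoc_of% h1, reassoc_of% h2, π_act]
  have h3 := π_condition M N
  simp only [whiskerLeft_comp, Category.assoc] at h3
  have hM' := congrArg (· ▷ N.X) hM
  simp only [comp_whiskerRight] at hM'
  have hN' := congrArg (M.X ◁ ·) hN
  simp only [whiskerLeft_comp] at hN'
  simp only [BraidedCategory.braiding_tensor_left_hom,
      BraidedCategory.braiding_tensor_right_hom, Category.assoc, Iso.inv_hom_id_assoc,
      Iso.hom_inv_id_assoc]
  rw [← h3, reassoc_of% hM', h3]
  simp only [Iso.inv_hom_id_assoc]
  rw [reassoc_of% hN']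

instance : (IsLocal (A := A)).IsMonoidal where
  prop_unit := by
    change (β_ A A).hom ≫ (β_ A A).hom ≫ μ = μ
    rw [IsCommMonObj.mul_comm, IsCommMonObj.mul_comm]
  prop_tensor _ _ h₁ h₂ := tensor_isLocal h₁ h₂

theorem braidAux_condition (M N : RMod A) (hM : IsLocal M) :
    M.act ▷ N.X ≫ (β_ M.X N.X).hom ≫ π N M =
      ((α_ M.X A N.X).hom ≫ M.X ◁ ((β_ A N.X).hom ≫ N.act)) ≫ (β_ M.X N.X).hom ≫ π N M := by
  change _ = _ at hM
  have hM' := congrArg (N.X ◁ ·) hM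
  simp only [whiskerLeft_comp] at hM'
  have h3 := π_condition N M
  simp only [whiskerLeft_comp, Category.assoc] at h3
  have h1 := BraidedCategory.braiding_naturality_left M.act N.X
  have h2 := BraidedCategory.braiding_naturality_right M.X N.act
  simp only [whiskerLeft_comp, Category.assoc]
  rw [reassoc_of% h1, reassoc_of% h2, h3]
  simp only [BraidedCategory.braiding_tensor_left_hom,
      BraidedCategory.braiding_tensor_right_hom, Category.assoc, Iso.inv_hom_id_assoc,
      Iso.hom_inv_id_assoc]
  rw [reassoc_of% hM']

theorem braidInvAux_condition (M N : RMod A) (hM : IsLocal M) :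
    N.act ▷ M.X ≫ (β_ M.X N.X).inv ≫ π M N =
      ((α_ N.X A M.X).hom ≫ N.X ◁ ((β_ A M.X).hom ≫ M.act)) ≫ (β_ M.X N.X).inv ≫ π M N := by
  change _ = _ at hM
  have hM' := congrArg (N.X ◁ ·) hM
  simp only [whiskerLeft_comp] at hM'
  have h3 := π_condition M N
  simp only [whiskerLeft_comp, Category.assoc] at h3
  have h1 := BraidedCategory.braiding_inv_naturality_left N.act M.X
  have h2 := BraidedCategory.braiding_inv_naturality_right N.X M.act
  simp only [whiskerLeft_comp, Category.assoc]
  rw [reassoc_of% h1, ← cancel_epi (β_ M.X (N.X ⊗ A)).hom, Iso.hom_inv_id_assoc]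
  simp only [BraidedCategory.braiding_tensor_right_hom, Category.assoc, Iso.inv_hom_id_assoc]
  rw [reassoc_of% hM', reassoc_of% h2, h3]
  simp only [BraidedCategory.braiding_tensor_left_inv, Category.assoc, Iso.inv_hom_id_assoc,
    Iso.hom_inv_id_assoc, whiskerLeft_inv_hom_assoc, hom_inv_whiskerRight_assoc]

/-- The braiding on local modules, as a morphism of underlying objects. -/
noncomputable def braidX (M N : RMod A) (hM : IsLocal M) : tensorX M N ≅ tensorX N M where
  hom := desc ((β_ M.X N.X).hom ≫ π N M) (braidAux_condition M N hM)
  inv := desc ((β_ M.X N.X).inv ≫ π M N) (braidInvAux_condition M N hM)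
  hom_inv_id := by
    rw [← cancel_epi (π M N), ← Category.assoc, π_desc, Category.assoc, π_desc]
    simp
  inv_hom_id := by
    rw [← cancel_epi (π N M), ← Category.assoc, π_desc, Category.assoc, π_desc]
    simp

theorem π_braidX (M N : RMod A) (hM : IsLocal M) :
    π M N ≫ (braidX M N hM).hom = (β_ M.X N.X).hom ≫ π N M :=
  π_desc _ _

theorem braidX_act (M N : RMod A) (hM : IsLocal M) :
    tensorAct M N ≫ (braidX M N hM).hom = (braidX M N hM).hom ▷ A ≫ tensorAct N M := by
  rw [← cancel_epi (π M N ▷ A), reassoc_of% (π_act M N), π_braidX, ← comp_whiskerRight_assoc,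
    π_braidX, comp_whiskerRight_assoc, π_act]
  change _ = _ at hM
  have hM' := congrArg (N.X ◁ ·) hM
  simp only [whiskerLeft_comp] at hM'
  have h2 := BraidedCategory.braiding_naturality_right M.X N.act
  have h3 := π_condition N M
  simp only [whiskerLeft_comp, Category.assoc] at h3
  rw [reassoc_of% h2, h3]
  simp only [BraidedCategory.braiding_tensor_right_hom, Category.assoc, Iso.inv_hom_id_assoc,
      Iso.hom_inv_id_assoc]
  rw [reassoc_of% hM']

/-- The braiding of local modules is induced by the braiding of the ambient category. -/
noncomputable def braid (M N : RMod A) (hM : IsLocal M) : M ⊗ N ≅ N ⊗ M :=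
  isoMk (braidX M N hM) (braidX_act M N hM)

/-- The canonical map `M ⊗ N ⟶ M ⊗[A] N`. -/
noncomputable def proj (M N : RMod A) : M.X ⊗ N.X ⟶ (M ⊗ N : RMod A).X := π M N

instance (M N : RMod A) : Epi (proj M N) := inferInstanceAs (Epi (π M N))
instance (M N : RMod A) (X : C) : Epi (proj M N ▷ X) := inferInstanceAs (Epi (π M N ▷ X))
instance (M N : RMod A) (X : C) : Epi (X ◁ proj M N) := inferInstanceAs (Epi (X ◁ π M N))

theorem proj_braid (M N : RMod A) (hM : IsLocal M) :
    proj M N ≫ (braid M N hM).hom.hom = (β_ M.X N.X).hom ≫ proj N M :=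
  π_desc _ _

theorem proj_whiskerLeft (M : RMod A) {N N' : RMod A} (f : N ⟶ N') :
    proj M N ≫ (M ◁ f).hom = M.X ◁ f.hom ≫ proj M N' := by
  have h : (M ◁ f).hom = (Bimod.whiskerLeft M.toBimod (toBimodFunctor.map f)).hom :=
    (Category.id_comp _).trans (Category.comp_id _)
  rw [h]
  exact (ι_colimMap _ _).trans rfl

theorem proj_whiskerRight {M M' : RMod A} (f : M ⟶ M') (N : RMod A) :
    proj M N ≫ (f ▷ N).hom = f.hom ▷ N.X ≫ proj M' N := by
  have h : (f ▷ N).hom = (Bimod.whiskerRight (toBimodFunctor.map f) N.toBimod).hom :=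
    (Category.id_comp _).trans (Category.comp_id _)
  rw [h]
  exact (ι_colimMap _ _).trans rfl

/-- The canonical map to the tensor product of bimodules. -/
noncomputable def bproj {R S T : Mon C} (P : Bimod R S) (Q : Bimod S T) :
    P.X ⊗ Q.X ⟶ (P.tensorBimod Q).X :=
  coequalizer.π (P.actRight ▷ Q.X) ((α_ _ _ _).hom ≫ (P.X ◁ Q.actLeft))

theorem bproj_whiskerRight {R S T : Mon C} {P P' : Bimod R S} (f : P ⟶ P') (Q : Bimod S T) :
    bproj P Q ≫ (Bimod.whiskerRight f Q).hom = f.hom ▷ Q.X ≫ bproj P' Q :=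
  ι_colimMap _ _

theorem bproj_whiskerLeft {R S T : Mon C} (P : Bimod R S) {Q Q' : Bimod S T} (f : Q ⟶ Q') :
    bproj P Q ≫ (Bimod.whiskerLeft P f).hom = P.X ◁ f.hom ≫ bproj P Q' :=
  ι_colimMap _ _

theorem bproj_associator {R S T U : Mon C} (P : Bimod R S) (Q : Bimod S T) (L : Bimod T U) :
    bproj P Q ▷ L.X ≫ bproj (P.tensorBimod Q) L ≫ (Bimod.associatorBimod P Q L).hom.hom =
      (α_ P.X Q.X L.X).hom ≫ P.X ◁ bproj Q L ≫ bproj P (Q.tensorBimod L) := by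
  have h : bproj (P.tensorBimod Q) L ≫ (Bimod.associatorBimod P Q L).hom.hom =
    Bimod.AssociatorBimod.homAux P Q L := coequalizer.π_desc _ _
  rw [h]
  exact π_tensor_id_preserves_coequalizer_inv_desc _ _ _ _

theorem comp_eq_assoc {X Y Z W : C} {a : X ⟶ Y} {b : Y ⟶ Z} {d : X ⟶ Z} (h : a ≫ b = d)
    (c : Z ⟶ W) : a ≫ b ≫ c = d ≫ c := by
  rw [← h, Category.assoc]

theorem proj_associator (L M N : RMod A) :
    proj L M ▷ N.X ≫ proj (L ⊗ M) N ≫ (α_ L M N).hom.hom =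
      (α_ L.X M.X N.X).hom ≫ L.X ◁ proj M N ≫ proj L (M ⊗ N) := by
  have e : (α_ L M N).hom.hom = (Bimod.whiskerRight (tensorIso L M).inv N.toBimod).hom ≫
      (Bimod.associatorBimod L.toBimod M.toBimod N.toBimod).hom.hom ≫
        (Bimod.whiskerLeft L.toBimod (tensorIso M N).hom).hom := by
    have e' : (α_ L M N).hom.hom =
      (𝟙 _ ≫ ((Bimod.whiskerRight (tensorIso L M).inv N.toBimod).hom ≫
        (Bimod.whiskerLeft _ (𝟙 N.toBimod)).hom)) ≫
      (Bimod.associatorBimod L.toBimod M.toBimod N.toBimod).hom.hom ≫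
        ((Bimod.whiskerRight (𝟙 L.toBimod) _).hom ≫
        (Bimod.whiskerLeft L.toBimod (tensorIso M N).hom).hom) ≫ 𝟙 _ := rfl
    rw [e', Bimod.whiskerLeft_id_bimod, Bimod.id_whiskerRight_bimod]
    rw [Bimod.id_hom', Bimod.id_hom', Category.id_comp, Category.id_comp, Category.comp_id,
      Category.comp_id]
  have h1 : proj (L ⊗ M) N ≫ (Bimod.whiskerRight (tensorIso L M).inv N.toBimod).hom =
      bproj (L.toBimod.tensorBimod M.toBimod) N.toBimod :=
    (bproj_whiskerRight (tensorIso L M).inv N.toBimod).trans (by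
      refine (congrArg (· ≫ _) (id_whiskerRight (tensorX L M) N.X)).trans (Category.id_comp _))
  have h2 : bproj L.toBimod (M.toBimod.tensorBimod N.toBimod) ≫
      (Bimod.whiskerLeft L.toBimod (tensorIso M N).hom).hom = proj L (M ⊗ N) :=
    (bproj_whiskerLeft L.toBimod (tensorIso M N).hom).trans (by
      refine (congrArg (· ≫ _) (whiskerLeft_id L.X (tensorX M N))).trans (Category.id_comp _))
  have h3 := bproj_associator L.toBimod M.toBimod N.toBimod
  have h4 := congrArg (· ≫ (Bimod.whiskerLeft L.toBimod (tensorIso M N).hom).hom) h3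
  simp only [Category.assoc] at h4
  refine (congrArg (fun t => proj L M ▷ N.X ≫ proj (L ⊗ M) N ≫ t) e).trans ?_
  refine (congrArg (fun t => proj L M ▷ N.X ≫ t) (comp_eq_assoc h1 _)).trans (h4.trans ?_)
  exact congrArg (fun t => (α_ L.X M.X N.X).hom ≫ L.X ◁ proj M N ≫ t) h2

theorem proj_leftUnitor (M : RMod A) :
    proj (𝟙_ _) M ≫ (λ_ M).hom.hom = (β_ A M.X).hom ≫ M.act := by
  have e : (λ_ M).hom.hom = (Bimod.whiskerRight unitIso.inv M.toBimod).hom ≫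
      (Bimod.leftUnitorBimod M.toBimod).hom.hom := by
    have e' : (λ_ M).hom.hom =
      (𝟙 _ ≫ ((Bimod.whiskerRight unitIso.inv M.toBimod).hom ≫
        (Bimod.whiskerLeft _ (𝟙 M.toBimod)).hom)) ≫
      (Bimod.leftUnitorBimod M.toBimod).hom.hom := rfl
    rw [e', Bimod.whiskerLeft_id_bimod]
    rw [Bimod.id_hom', Category.id_comp, Category.comp_id]
  have h1 : proj (𝟙_ _) M ≫ (Bimod.whiskerRight unitIso.inv M.toBimod).hom =
      bproj (Bimod.regular (Mon.mk A)) M.toBimod :=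
    (bproj_whiskerRight unitIso.inv M.toBimod).trans (by
      refine (congrArg (· ≫ _) (id_whiskerRight A M.X)).trans (Category.id_comp _))
  refine (congrArg (fun t => proj _ _ ≫ t) e).trans ((comp_eq_assoc h1 _).trans ?_)
  exact coequalizer.π_desc _ _

theorem proj_rightUnitor (M : RMod A) :
    proj M (𝟙_ _) ≫ (ρ_ M).hom.hom = M.act := by
  have e : (ρ_ M).hom.hom = (Bimod.whiskerLeft M.toBimod unitIso.inv).hom ≫
      (Bimod.rightUnitorBimod M.toBimod).hom.hom := by
    have e' : (ρ_ M).hom.hom =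
      (𝟙 _ ≫ ((Bimod.whiskerRight (𝟙 M.toBimod) _).hom ≫
        (Bimod.whiskerLeft M.toBimod unitIso.inv).hom)) ≫
      (Bimod.rightUnitorBimod M.toBimod).hom.hom := rfl
    rw [e', Bimod.id_whiskerRight_bimod]
    rw [Bimod.id_hom', Category.id_comp, Category.id_comp]
  have h1 : proj M (𝟙_ _) ≫ (Bimod.whiskerLeft M.toBimod unitIso.inv).hom =
      bproj M.toBimod (Bimod.regular (Mon.mk A)) :=
    (bproj_whiskerLeft M.toBimod unitIso.inv).trans (by
      refine (congrArg (· ≫ _) (whiskerLeft_id M.X A)).trans (Category.id_comp _))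
  refine (congrArg (fun t => proj _ _ ≫ t) e).trans ((comp_eq_assoc h1 _).trans ?_)
  exact coequalizer.π_desc _ _

theorem braid_naturality_right (X : RMod A) (hX : IsLocal X) {Y Z : RMod A} (f : Y ⟶ Z) :
    X ◁ f ≫ (braid X Z hX).hom = (braid X Y hX).hom ≫ f ▷ X := by
  apply hom_ext
  rw [comp_hom, comp_hom, ← cancel_epi (proj X Y), reassoc_of% (proj_whiskerLeft X f), proj_braid,
    reassoc_of% (proj_braid X Y), proj_whiskerRight]
  simp

theorem braid_naturality_left {X Y : RMod A} (hX : IsLocal X) (hY : IsLocal Y) (f : X ⟶ Y)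
    (Z : RMod A) : f ▷ Z ≫ (braid Y Z hY).hom = (braid X Z hX).hom ≫ Z ◁ f := by
  apply hom_ext
  rw [comp_hom, comp_hom, ← cancel_epi (proj X Z), reassoc_of% (proj_whiskerRight f Z), proj_braid,
    reassoc_of% (proj_braid X Z), proj_whiskerLeft]
  simp

theorem hexagon_forward (X Y Z : RMod A) (hX : IsLocal X) :
    (α_ X Y Z).hom ≫ (braid X (Y ⊗ Z) hX).hom ≫ (α_ Y Z X).hom =
      ((braid X Y hX).hom ▷ Z) ≫ (α_ Y X Z).hom ≫ (Y ◁ (braid X Z hX).hom) := by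
  apply hom_ext
  simp only [comp_hom]
  rw [← cancel_epi (proj (X ⊗ Y) Z), ← cancel_epi (proj X Y ▷ Z.X)]
  have a1 := proj_associator X Y Z
  have a2 := proj_associator Y Z X
  have a3 := proj_associator Y X Z
  have b1 := proj_braid X (Y ⊗ Z) hX
  have b2 := BraidedCategory.braiding_naturality_right X.X (proj Y Z)
  have b3 := proj_whiskerRight (braid X Y hX).hom Z
  have b4 := congrArg (· ▷ Z.X) (proj_braid X Y hX)
  have b5 := proj_whiskerLeft Y (braid X Z hX).hom
  have b6 := congrArg (Y.X ◁ ·) (proj_braid X Z hX)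
  simp only [comp_whiskerRight, whiskerLeft_comp] at b4 b6
  rw [reassoc_of% a1, reassoc_of% b1, reassoc_of% b2, a2, reassoc_of% b3, reassoc_of% b4,
    reassoc_of% a3, b5, reassoc_of% b6]
  simp

theorem hexagon_reverse (X Y Z : RMod A) (hX : IsLocal X) (hY : IsLocal Y)
    (hXY : IsLocal (X ⊗ Y)) :
    (α_ X Y Z).inv ≫ (braid (X ⊗ Y) Z hXY).hom ≫ (α_ Z X Y).inv =
      (X ◁ (braid Y Z hY).hom) ≫ (α_ X Z Y).inv ≫ ((braid X Z hX).hom ▷ Y) := by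
  rw [Iso.inv_comp_eq, ← cancel_mono (α_ Z X Y).hom]
  simp only [Category.assoc, Iso.inv_hom_id, Category.comp_id]
  apply hom_ext
  simp only [comp_hom]
  rw [← cancel_epi (proj (X ⊗ Y) Z), ← cancel_epi (proj X Y ▷ Z.X)]
  have a1 := proj_associator X Y Z
  have a2 := proj_associator Z X Y
  have a3 : X.X ◁ proj Z Y ≫ proj X (Z ⊗ Y) ≫ (α_ X Z Y).inv.hom =
      (α_ X.X Z.X Y.X).inv ≫ proj X Z ▷ Y.X ≫ proj (X ⊗ Z) Y := by
    rw [Iso.eq_inv_comp, ← reassoc_of% (proj_associator X Z Y), ← comp_hom, Iso.hom_inv_id,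
      id_hom, Category.comp_id]
  have b1 := proj_braid (X ⊗ Y) Z hXY
  have b2 := BraidedCategory.braiding_naturality_left (proj X Y) Z.X
  have b3 := proj_whiskerRight (braid X Z hX).hom Y
  have b4 := congrArg (· ▷ Y.X) (proj_braid X Z hX)
  have b5 := proj_whiskerLeft X (braid Y Z hY).hom
  have b6 := congrArg (X.X ◁ ·) (proj_braid Y Z hY)
  simp only [comp_whiskerRight, whiskerLeft_comp] at b4 b6
  have a2' : Z.X ◁ proj X Y ≫ proj Z (X ⊗ Y) =
      (α_ Z.X X.X Y.X).inv ≫ proj Z X ▷ Y.X ≫ proj (Z ⊗ X) Y ≫ (α_ Z X Y).hom.hom := by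
    rw [a2, Iso.inv_hom_id_assoc]
  rw [b1, reassoc_of% b2, a2', reassoc_of% a1, reassoc_of% b5, reassoc_of% b6, reassoc_of% a3,
    reassoc_of% b3, reassoc_of% b4]
  simp

end RMod

/-- The category of local modules over a commutative algebra. -/
abbrev LocMod (A : C) [MonObj A] [IsCommMonObj A] := (RMod.IsLocal (A := A)).FullSubcategory

namespace LocMod

variable {A : C} [MonObj A] [IsCommMonObj A] [HasCoequalizers C]
variable [∀ X : C, PreservesColimitsOfSize.{0, 0} (tensorLeft X)]
variable [∀ X : C, PreservesColimitsOfSize.{0, 0} (tensorRight X)]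

open RMod

noncomputable instance : BraidedCategory (LocMod A) where
  braiding M N := (IsLocal (A := A)).isoMk (braid M.obj N.obj M.property)
  braiding_naturality_right X _ _ f :=
    ObjectProperty.hom_ext _ (braid_naturality_right X.obj X.property f.hom)
  braiding_naturality_left {X Y} f Z :=
    ObjectProperty.hom_ext _ (braid_naturality_left X.property Y.property f.hom Z.obj)
  hexagon_forward X Y Z := ObjectProperty.hom_ext _ (hexagon_forward X.obj Y.obj Z.obj X.property)
  hexagon_reverse X Y Z := ObjectProperty.hom_ext _
    (hexagon_reverse X.obj Y.obj Z.obj X.property Y.property (X ⊗ Y).property)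

end LocMod

end Braided

section Ribbon

variable (C : Type u₁) [Category.{v₁} C] [MonoidalCategory C] [BraidedCategory C]

/-- Ribbon categories: rigid braided categories with a natural self-dual twist, normalised so that
the double braiding of `X` and `Y` is `θ (X ⊗ Y)⁻¹ ∘ (θ X ⊗ θ Y)`. -/
class RibbonCategory extends RigidCategory C where
  twist : 𝟭 C ≅ 𝟭 C
  twist_tensor : ∀ X Y : C, twist.hom.app X ⊗ₘ twist.hom.app Y =
    (β_ X Y).hom ≫ (β_ Y X).hom ≫ twist.hom.app (X ⊗ Y)
  twist_dual : ∀ X : C, twist.hom.app (Xᘁ) = (twist.hom.app X)ᘁ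

variable {C}

/-- The twist of an object of a ribbon category. -/
def θ [RibbonCategory C] (X : C) : X ⟶ X := (RibbonCategory.twist (C := C)).hom.app X

/-- An algebra is separable if it has a form `ε` such that `ε ∘ μ` is a non-degenerate pairing. -/
def IsSeparable {C : Type u₁} [Category.{v₁} C] [MonoidalCategory C] (A : C) [MonObj A] : Prop :=
  ∃ (ε : A ⟶ 𝟙_ C) (κ : 𝟙_ C ⟶ A ⊗ A),
    (ρ_ A).inv ≫ A ◁ κ ≫ (α_ A A A).inv ≫ (μ ≫ ε) ▷ A ≫ (λ_ A).hom = 𝟙 A ∧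
    (λ_ A).inv ≫ κ ▷ A ≫ (α_ A A A).hom ≫ A ◁ (μ ≫ ε) ≫ (ρ_ A).hom = 𝟙 A

end Ribbon

attribute [local instance] Fintype.ofFinite

/-- Objects of `𝒵(G)`: finite-dimensional `G`-graded vector spaces `V` with a compatible `G`-action.
The grading is given by its projections `pr g` onto the homogeneous components; compatibility is
`f (V_g) = V_{f g f⁻¹}`. -/
structure ZCat (k : Type u) [Field k] (G : Type u) [Group G] [Finite G] where
  V : Type u
  [addCommGroup : AddCommGroup V]
  [module : Module k V]
  [finite : FiniteDimensional k V]
  ρ : Representation k G V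
  pr : G → V →ₗ[k] V
  pr_self : ∀ g v, pr g (pr g v) = pr g v
  pr_ne : ∀ g h v, g ≠ h → pr g (pr h v) = 0
  sum_pr : ∀ v, ∑ g, pr g v = v
  ρ_pr : ∀ f g v, ρ f (pr g v) = pr (f * g * f⁻¹) (ρ f v)

namespace ZCat

variable {k : Type u} [Field k] {G : Type u} [Group G] [Finite G]

attribute [instance] ZCat.addCommGroup ZCat.module ZCat.finite

/-- The homogeneous component of degree `g`. -/
def grade (X : ZCat k G) (g : G) : Submodule k X.V := LinearMap.range (X.pr g)

theorem mem_grade {X : ZCat k G} {g : G} {v : X.V} : v ∈ X.grade g ↔ X.pr g v = v :=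
  ⟨by rintro ⟨w, rfl⟩; exact X.pr_self g w, fun h => ⟨v, h⟩⟩

theorem pr_mem (X : ZCat k G) (g : G) (v : X.V) : X.pr g v ∈ X.grade g := ⟨v, rfl⟩

open scoped Classical in
theorem pr_of_mem {X : ZCat k G} {g : G} {v : X.V} (h : v ∈ X.grade g) (f : G) :
    X.pr f v = if f = g then v else 0 := by
  split_ifs with hf
  · subst hf; exact mem_grade.1 h
  · rw [← mem_grade.1 h]; exact X.pr_ne f g v hf

theorem ρ_mem {X : ZCat k G} {g : G} {v : X.V} (h : v ∈ X.grade g) (f : G) :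
    X.ρ f v ∈ X.grade (f * g * f⁻¹) := by
  rw [mem_grade, ← X.ρ_pr, mem_grade.1 h]

open scoped Classical in
/-- The homogeneous components form a direct sum decomposition. -/
theorem grade_isInternal (X : ZCat k G) : DirectSum.IsInternal X.grade := by
  rw [DirectSum.isInternal_submodule_iff_iSupIndep_and_iSup_eq_top]
  constructor
  · rw [iSupIndep_def]
    intro g
    rw [Submodule.disjoint_def]
    intro v hv hv'
    rw [← mem_grade.1 hv]
    have : (⨆ j, ⨆ (_ : j ≠ g), X.grade j) ≤ LinearMap.ker (X.pr g) := by
      refine iSup₂_le fun j hj w hw => ?_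
      rw [LinearMap.mem_ker, pr_of_mem hw, if_neg hj.symm]
    exact this hv'
  · rw [eq_top_iff]
    intro v _
    rw [← X.sum_pr v]
    exact Submodule.sum_mem _ fun g _ => Submodule.mem_iSup_of_mem g (X.pr_mem g v)

/-- Linear maps agree if they agree on homogeneous elements. -/
theorem ext_grade {X : ZCat k G} {W : Type*} [AddCommGroup W] [Module k W] {S T : X.V →ₗ[k] W}
    (h : ∀ g, ∀ v ∈ X.grade g, S v = T v) : S = T := by
  ext v
  rw [← X.sum_pr v, map_sum, map_sum]
  exact Finset.sum_congr rfl fun g _ => h g _ (X.pr_mem g v)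

/-- A linear map commutes with the projections as soon as it maps homogeneous elements to
elements fixed by the projection of the same degree. -/
theorem comm_of_grade {X : ZCat k G} {W : Type*} [AddCommGroup W] [Module k W]
    {P : G → W →ₗ[k] W} {T : X.V →ₗ[k] W}
    (h : ∀ g, ∀ v ∈ X.grade g, ∀ f, P f (T v) = T (X.pr f v)) (g : G) (v : X.V) :
    T (X.pr g v) = P g (T v) :=
  LinearMap.congr_fun (ext_grade (S := T ∘ₗ X.pr g) (T := P g ∘ₗ T)
    fun f w hw => (h f w hw g).symm) v

theorem comm_of_mem {X Y : ZCat k G} {T : X.V →ₗ[k] Y.V}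
    (h : ∀ g, ∀ v ∈ X.grade g, T v ∈ Y.grade g) (g : G) (v : X.V) :
    T (X.pr g v) = Y.pr g (T v) := by
  refine comm_of_grade (fun a w hw f => ?_) g v
  rw [pr_of_mem hw, pr_of_mem (h a w hw)]
  split_ifs <;> simp

/-- Morphisms: linear maps preserving the action and the grading. -/
@[ext]
structure Hom (X Y : ZCat k G) where
  hom : X.V →ₗ[k] Y.V
  comm_ρ : ∀ g v, hom (X.ρ g v) = Y.ρ g (hom v)
  comm_pr : ∀ g v, hom (X.pr g v) = Y.pr g (hom v)

instance : Category (ZCat k G) where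
  Hom X Y := Hom X Y
  id X := ⟨LinearMap.id, fun _ _ => rfl, fun _ _ => rfl⟩
  comp f g := ⟨g.hom ∘ₗ f.hom, fun _ _ => by simp [f.comm_ρ, g.comm_ρ],
    fun _ _ => by simp [f.comm_pr, g.comm_pr]⟩

@[ext]
theorem hom_ext {X Y : ZCat k G} (f g : X ⟶ Y) (h : f.hom = g.hom) : f = g := Hom.ext h

@[simp] theorem id_hom (X : ZCat k G) : Hom.hom (𝟙 X) = LinearMap.id := rfl

@[simp] theorem comp_hom {X Y Z : ZCat k G} (f : X ⟶ Y) (g : Y ⟶ Z) :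
    (f ≫ g).hom = g.hom ∘ₗ f.hom := rfl

theorem hom_mem {X Y : ZCat k G} (f : X ⟶ Y) {g : G} {v : X.V} (h : v ∈ X.grade g) :
    f.hom v ∈ Y.grade g := by
  rw [mem_grade, ← f.comm_pr, mem_grade.1 h]

/-- An isomorphism from a linear equivalence. -/
@[simps]
def isoMk {X Y : ZCat k G} (e : X.V ≃ₗ[k] Y.V) (h₁ : ∀ g v, e (X.ρ g v) = Y.ρ g (e v))
    (h₂ : ∀ g v, e (X.pr g v) = Y.pr g (e v)) : X ≅ Y where
  hom := ⟨e.toLinearMap, h₁, h₂⟩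
  inv := ⟨e.symm.toLinearMap, fun g v => by
      change e.symm _ = X.ρ g (e.symm v)
      rw [LinearEquiv.symm_apply_eq, h₁, LinearEquiv.apply_symm_apply], fun g v => by
      change e.symm _ = X.pr g (e.symm v)
      rw [LinearEquiv.symm_apply_eq, h₂, LinearEquiv.apply_symm_apply]⟩
  hom_inv_id := by ext v; exact e.symm_apply_apply v
  inv_hom_id := by ext v; exact e.apply_symm_apply v

section Linear

instance (X Y : ZCat k G) : Add (X ⟶ Y) where
  add f g := ⟨f.hom + g.hom, fun _ _ => by simp [f.comm_ρ, g.comm_ρ],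
    fun _ _ => by simp [f.comm_pr, g.comm_pr]⟩

instance (X Y : ZCat k G) : Zero (X ⟶ Y) where
  zero := ⟨0, fun _ _ => by simp, fun _ _ => by simp⟩

instance (X Y : ZCat k G) : Neg (X ⟶ Y) where
  neg f := ⟨-f.hom, fun _ _ => by simp [f.comm_ρ], fun _ _ => by simp [f.comm_pr]⟩

instance (X Y : ZCat k G) : SMul k (X ⟶ Y) where
  smul r f := ⟨r • f.hom, fun _ _ => by simp [f.comm_ρ], fun _ _ => by simp [f.comm_pr]⟩

instance (X Y : ZCat k G) : AddCommGroup (X ⟶ Y) where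
  add_assoc f g h := hom_ext _ _ (add_assoc f.hom g.hom h.hom)
  zero_add f := hom_ext _ _ (zero_add f.hom)
  add_zero f := hom_ext _ _ (add_zero f.hom)
  neg_add_cancel f := hom_ext _ _ (neg_add_cancel f.hom)
  add_comm f g := hom_ext _ _ (add_comm f.hom g.hom)
  nsmul := nsmulRec
  zsmul := zsmulRec

@[simp] theorem add_hom {X Y : ZCat k G} (f g : X ⟶ Y) : (f + g).hom = f.hom + g.hom := rfl
@[simp] theorem zero_hom {X Y : ZCat k G} : (0 : X ⟶ Y).hom = 0 := rfl
@[simp] theorem neg_hom {X Y : ZCat k G} (f : X ⟶ Y) : (-f).hom = -f.hom := rfl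
@[simp] theorem smul_hom {X Y : ZCat k G} (r : k) (f : X ⟶ Y) : (r • f).hom = r • f.hom := rfl

instance : Preadditive (ZCat k G) where
  add_comp _ _ _ f g h := hom_ext _ _ (LinearMap.comp_add f.hom g.hom h.hom)
  comp_add _ _ _ f g h := hom_ext _ _ (LinearMap.add_comp f.hom h.hom g.hom)

instance (X Y : ZCat k G) : Module k (X ⟶ Y) where
  one_smul f := hom_ext _ _ (one_smul k f.hom)
  mul_smul r s f := hom_ext _ _ (mul_smul r s f.hom)
  smul_zero r := hom_ext _ _ (smul_zero (A := X.V →ₗ[k] Y.V) r)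
  smul_add r f g := hom_ext _ _ (smul_add r f.hom g.hom)
  add_smul r s f := hom_ext _ _ (add_smul r s f.hom)
  zero_smul f := hom_ext _ _ (zero_smul k f.hom)

instance : Linear k (ZCat k G) where
  smul_comp _ _ _ r f g := hom_ext _ _ (LinearMap.comp_smul g.hom r f.hom)
  comp_smul _ _ _ f r g := hom_ext _ _ (LinearMap.smul_comp r g.hom f.hom)

end Linear

section Monoidal

open TensorProduct

/-- Projections of the tensor product grading, `(X ⊗ Y)_g = ⨁_{a b = g} X_a ⊗ Y_b`. -/
noncomputable def tensorPr (X Y : ZCat k G) (g : G) : X.V ⊗[k] Y.V →ₗ[k] X.V ⊗[k] Y.V :=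
  ∑ a, TensorProduct.map (X.pr a) (Y.pr (a⁻¹ * g))

open scoped Classical in
theorem tensorPr_tmul {X Y : ZCat k G} {a b : G} {x : X.V} {y : Y.V} (hx : x ∈ X.grade a)
    (hy : y ∈ Y.grade b) (g : G) :
    tensorPr X Y g (x ⊗ₜ y) = if g = a * b then x ⊗ₜ y else 0 := by
  rw [tensorPr, LinearMap.sum_apply, Finset.sum_eq_single a]
  · rw [map_tmul, pr_of_mem hx, if_pos rfl, pr_of_mem hy, inv_mul_eq_iff_eq_mul]
    split_ifs <;> simp
  · intro c _ hc
    rw [map_tmul, pr_of_mem hx, if_neg hc, zero_tmul]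
  · simp

theorem tensor_ext {X Y : ZCat k G} {W : Type*} [AddCommGroup W] [Module k W]
    {S T : X.V ⊗[k] Y.V →ₗ[k] W}
    (h : ∀ a, ∀ x ∈ X.grade a, ∀ b, ∀ y ∈ Y.grade b, S (x ⊗ₜ y) = T (x ⊗ₜ y)) : S = T := by
  refine TensorProduct.ext (ext_grade fun a x hx => ext_grade fun b y hy => ?_)
  exact h a x hx b y hy

/-- The tensor product of graded vector spaces with the diagonal action. -/
noncomputable abbrev tensor (X Y : ZCat k G) : ZCat k G where
  V := X.V ⊗[k] Y.V
  ρ := X.ρ.tprod Y.ρ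
  pr := tensorPr X Y
  pr_self g v := by
    refine LinearMap.congr_fun (f := tensorPr X Y g ∘ₗ tensorPr X Y g) (g := tensorPr X Y g)
      (tensor_ext fun a x hx b y hy => ?_) v
    rw [LinearMap.comp_apply, tensorPr_tmul hx hy]
    split_ifs with h
    · rw [tensorPr_tmul hx hy, if_pos h]
    · simp
  pr_ne g h v hgh := by
    refine LinearMap.congr_fun (f := tensorPr X Y g ∘ₗ tensorPr X Y h) (g := 0)
      (tensor_ext fun a x hx b y hy => ?_) v
    rw [LinearMap.comp_apply, tensorPr_tmul hx hy]
    split_ifs with h'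
    · rw [tensorPr_tmul hx hy, if_neg (h' ▸ hgh)]; simp
    · simp
  sum_pr v := by
    classical
    have := LinearMap.congr_fun (f := ∑ g, tensorPr X Y g) (g := LinearMap.id)
      (tensor_ext fun a x hx b y hy => ?_) v
    · rwa [LinearMap.sum_apply] at this
    rw [LinearMap.sum_apply, Finset.sum_congr rfl fun g _ => tensorPr_tmul hx hy g]
    simp
  ρ_pr f g v := by
    refine LinearMap.congr_fun (f := (X.ρ.tprod Y.ρ f) ∘ₗ tensorPr X Y g)
      (g := tensorPr X Y (f * g * f⁻¹) ∘ₗ (X.ρ.tprod Y.ρ f))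
      (tensor_ext fun a x hx b y hy => ?_) v
    have e : f * a * f⁻¹ * (f * b * f⁻¹) = f * (a * b) * f⁻¹ := by group
    rw [LinearMap.comp_apply, LinearMap.comp_apply, tensorPr_tmul hx hy, Representation.tprod_apply,
      map_tmul, tensorPr_tmul (ρ_mem hx f) (ρ_mem hy f), e]
    by_cases h : g = a * b
    · rw [if_pos h, if_pos (by rw [h]), map_tmul]
    · rw [if_neg h, if_neg (by simpa using h), map_zero]

open scoped Classical in
/-- The unit object: the trivial representation in degree `1`. -/
noncomputable abbrev unit : ZCat k G where
  V := k
  ρ := Representation.trivial k G k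
  pr g := if g = 1 then LinearMap.id else 0
  pr_self g v := by split_ifs <;> simp
  pr_ne g h v hgh := by
    by_cases h1 : g = 1
    · rw [if_neg (fun h2 => hgh (h1.trans h2.symm) : ¬ h = 1)]; simp
    · rw [if_neg h1]; simp
  sum_pr v := by
    rw [Finset.sum_eq_single 1] <;> simp +contextual
  ρ_pr f g v := by
    by_cases h : g = 1
    · subst h; simp
    · have h' : ¬ f * g * f⁻¹ = 1 := by simpa using h
      rw [if_neg h, if_neg h']; simp

theorem tmul_mem {X Y : ZCat k G} {a b : G} {x : X.V} {y : Y.V} (hx : x ∈ X.grade a)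
    (hy : y ∈ Y.grade b) : (x ⊗ₜ y : X.V ⊗[k] Y.V) ∈ (tensor X Y).grade (a * b) := by
  rw [mem_grade]
  exact (tensorPr_tmul hx hy _).trans (if_pos rfl)

theorem unit_mem (r : k) : r ∈ (unit (k := k) (G := G)).grade 1 := by
  rw [mem_grade]; simp [unit]

/-- The tensor product of morphisms. -/
noncomputable def tensorHom {X X' Y Y' : ZCat k G} (f : X ⟶ X') (g : Y ⟶ Y') :
    tensor X Y ⟶ tensor X' Y' where
  hom := TensorProduct.map f.hom g.hom
  comm_ρ a v := by
    refine LinearMap.congr_fun (f := TensorProduct.map f.hom g.hom ∘ₗ X.ρ.tprod Y.ρ a)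
      (g := X'.ρ.tprod Y'.ρ a ∘ₗ TensorProduct.map f.hom g.hom) (TensorProduct.ext' ?_) v
    intro x y
    simp [f.comm_ρ, g.comm_ρ]
  comm_pr a v := by
    refine LinearMap.congr_fun (f := TensorProduct.map f.hom g.hom ∘ₗ tensorPr X Y a)
      (g := tensorPr X' Y' a ∘ₗ TensorProduct.map f.hom g.hom) (tensor_ext ?_) v
    intro a x hx b y hy
    rw [LinearMap.comp_apply, LinearMap.comp_apply, map_tmul,
      tensorPr_tmul (hom_mem f hx) (hom_mem g hy), tensorPr_tmul hx hy]
    split_ifs <;> simp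

theorem tensor_comm_pr {X Y Z : ZCat k G} {T : X.V ⊗[k] Y.V →ₗ[k] Z.V}
    (h : ∀ a, ∀ x ∈ X.grade a, ∀ b, ∀ y ∈ Y.grade b, T (x ⊗ₜ y) ∈ Z.grade (a * b))
    (g : G) (v : X.V ⊗[k] Y.V) : T (tensorPr X Y g v) = Z.pr g (T v) := by
  refine LinearMap.congr_fun (f := T ∘ₗ tensorPr X Y g) (g := Z.pr g ∘ₗ T) (tensor_ext ?_) v
  intro a x hx b y hy
  rw [LinearMap.comp_apply, LinearMap.comp_apply, tensorPr_tmul hx hy,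
    pr_of_mem (h a x hx b y hy)]
  split_ifs <;> simp

noncomputable def associator (X Y Z : ZCat k G) :
    tensor (tensor X Y) Z ≅ tensor X (tensor Y Z) :=
  isoMk (TensorProduct.assoc k X.V Y.V Z.V)
    (fun g v => by
      refine LinearMap.congr_fun (f := (TensorProduct.assoc k X.V Y.V Z.V).toLinearMap ∘ₗ
          (X.ρ.tprod Y.ρ).tprod Z.ρ g)
        (g := X.ρ.tprod (Y.ρ.tprod Z.ρ) g ∘ₗ (TensorProduct.assoc k X.V Y.V Z.V).toLinearMap)
        (TensorProduct.ext_threefold fun _ _ _ => rfl) v)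
    (fun g v => by
      refine LinearMap.congr_fun (f := (TensorProduct.assoc k X.V Y.V Z.V).toLinearMap ∘ₗ
          tensorPr (tensor X Y) Z g)
        (g := tensorPr X (tensor Y Z) g ∘ₗ (TensorProduct.assoc k X.V Y.V Z.V).toLinearMap)
        ?_ v
      refine TensorProduct.ext (TensorProduct.ext (ext_grade fun a x hx => ext_grade fun b y hy =>
        ext_grade fun c z hz => ?_))
      change TensorProduct.assoc k X.V Y.V Z.V (tensorPr (tensor X Y) Z g ((x ⊗ₜ y) ⊗ₜ z)) =
        tensorPr X (tensor Y Z) g (x ⊗ₜ (y ⊗ₜ z))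
      rw [tensorPr_tmul (tmul_mem hx hy) hz, tensorPr_tmul hx (tmul_mem hy hz), mul_assoc]
      split_ifs <;> simp)

noncomputable def leftUnitor (X : ZCat k G) : tensor unit X ≅ X :=
  isoMk (TensorProduct.lid k X.V)
    (fun g v => by
      refine LinearMap.congr_fun (f := (TensorProduct.lid k X.V).toLinearMap ∘ₗ
          (Representation.trivial k G k).tprod X.ρ g)
        (g := X.ρ g ∘ₗ (TensorProduct.lid k X.V).toLinearMap) (TensorProduct.ext' ?_) v
      intro r x
      simp)
    (tensor_comm_pr (X := unit) (Y := X) (Z := X) (T := (TensorProduct.lid k X.V).toLinearMap) (by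
      intro a r hr b x hx
      by_cases h : a = 1
      · subst h
        simpa using Submodule.smul_mem _ r hx
      · have h0 : r = 0 := by
          rw [← mem_grade.1 (unit_mem (k := k) (G := G) r), pr_of_mem hr, if_neg (Ne.symm h)]
        simp [h0]))

noncomputable def rightUnitor (X : ZCat k G) : tensor X unit ≅ X :=
  isoMk (TensorProduct.rid k X.V)
    (fun g v => by
      refine LinearMap.congr_fun (f := (TensorProduct.rid k X.V).toLinearMap ∘ₗ
          X.ρ.tprod (Representation.trivial k G k) g)
        (g := X.ρ g ∘ₗ (TensorProduct.rid k X.V).toLinearMap) (TensorProduct.ext' ?_) v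
      intro r x
      simp)
    (tensor_comm_pr (X := X) (Y := unit) (Z := X) (T := (TensorProduct.rid k X.V).toLinearMap) (by
      intro a x hx b r hr
      by_cases h : b = 1
      · subst h
        simpa using Submodule.smul_mem _ r hx
      · have h0 : r = 0 := by
          rw [← mem_grade.1 (unit_mem (k := k) (G := G) r), pr_of_mem hr, if_neg (Ne.symm h)]
        simp [h0]))

noncomputable instance : MonoidalCategoryStruct (ZCat k G) where
  tensorObj := tensor
  whiskerLeft X _ _ f := tensorHom (𝟙 X) f
  whiskerRight f Y := tensorHom f (𝟙 Y)
  tensorHom := tensorHom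
  tensorUnit := unit
  associator := associator
  leftUnitor := leftUnitor
  rightUnitor := rightUnitor

noncomputable instance : MonoidalCategory (ZCat k G) where
  tensorHom_def _ _ := hom_ext _ _ (TensorProduct.ext' fun _ _ => rfl)
  id_tensorHom_id _ _ := hom_ext _ _ (TensorProduct.ext' fun _ _ => rfl)
  tensorHom_comp_tensorHom _ _ _ _ := hom_ext _ _ (TensorProduct.ext' fun _ _ => rfl)
  whiskerLeft_id _ _ := hom_ext _ _ (TensorProduct.ext' fun _ _ => rfl)
  id_whiskerRight _ _ := hom_ext _ _ (TensorProduct.ext' fun _ _ => rfl)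
  associator_naturality _ _ _ := hom_ext _ _ (TensorProduct.ext_threefold fun _ _ _ => rfl)
  leftUnitor_naturality f := hom_ext _ _ (TensorProduct.ext' fun r x => (f.hom.map_smul r x).symm)
  rightUnitor_naturality f := hom_ext _ _ (TensorProduct.ext' fun x r => (f.hom.map_smul r x).symm)
  pentagon _ _ _ _ := hom_ext _ _ (TensorProduct.ext_fourfold fun _ _ _ _ => rfl)
  triangle _ _ := hom_ext _ _ (TensorProduct.ext_threefold fun x r y =>
    (TensorProduct.smul_tmul r x y).symm)

instance : MonoidalPreadditive (ZCat k G) where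
  whiskerLeft_zero := hom_ext _ _ (TensorProduct.ext' fun _ _ => TensorProduct.tmul_zero _ _)
  zero_whiskerRight := hom_ext _ _ (TensorProduct.ext' fun _ _ => TensorProduct.zero_tmul _ _)
  whiskerLeft_add _ _ := hom_ext _ _ (TensorProduct.ext' fun _ _ => TensorProduct.tmul_add _ _ _)
  add_whiskerRight _ _ := hom_ext _ _ (TensorProduct.ext' fun _ _ => TensorProduct.add_tmul _ _ _)

instance : MonoidalLinear k (ZCat k G) where
  whiskerLeft_smul _ _ _ _ _ :=
    hom_ext _ _ (TensorProduct.ext' fun _ _ => TensorProduct.tmul_smul _ _ _)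
  smul_whiskerRight _ _ _ _ _ :=
    hom_ext _ _ (TensorProduct.ext' fun _ _ => (TensorProduct.smul_tmul' _ _ _).symm)

end Monoidal

section Braided

open TensorProduct

/-- The braiding `x ⊗ y ↦ f y ⊗ x` for `x` of degree `f`. -/
noncomputable def braidMap (X Y : ZCat k G) : X.V ⊗[k] Y.V →ₗ[k] Y.V ⊗[k] X.V :=
  ∑ f, TensorProduct.map (Y.ρ f) (X.pr f) ∘ₗ (TensorProduct.comm k X.V Y.V).toLinearMap

/-- The inverse braiding `y ⊗ x ↦ x ⊗ f⁻¹ y` for `x` of degree `f`. -/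
noncomputable def braidInvMap (X Y : ZCat k G) : Y.V ⊗[k] X.V →ₗ[k] X.V ⊗[k] Y.V :=
  ∑ f, TensorProduct.map (X.pr f) (Y.ρ f⁻¹) ∘ₗ (TensorProduct.comm k Y.V X.V).toLinearMap

theorem braidMap_tmul {X : ZCat k G} (Y : ZCat k G) {f : G} {x : X.V} (hx : x ∈ X.grade f)
    (y : Y.V) : braidMap X Y (x ⊗ₜ y) = Y.ρ f y ⊗ₜ x := by
  rw [braidMap, LinearMap.sum_apply, Finset.sum_eq_single f]
  · simp [mem_grade.1 hx]
  · intro c _ hc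
    simp [pr_of_mem hx, hc]
  · simp

theorem braidInvMap_tmul {X : ZCat k G} (Y : ZCat k G) {f : G} {x : X.V} (hx : x ∈ X.grade f)
    (y : Y.V) : braidInvMap X Y (y ⊗ₜ x) = x ⊗ₜ Y.ρ f⁻¹ y := by
  rw [braidInvMap, LinearMap.sum_apply, Finset.sum_eq_single f]
  · simp [mem_grade.1 hx]
  · intro c _ hc
    simp [pr_of_mem hx, hc]
  · simp

theorem ρ_ρ_inv (X : ZCat k G) (g : G) (x : X.V) : X.ρ g (X.ρ g⁻¹ x) = x := by
  rw [← Module.End.mul_apply, ← map_mul]; simp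

theorem ρ_inv_ρ (X : ZCat k G) (g : G) (x : X.V) : X.ρ g⁻¹ (X.ρ g x) = x := by
  rw [← Module.End.mul_apply, ← map_mul]; simp

theorem ρ_mul (X : ZCat k G) (g h : G) (x : X.V) : X.ρ (g * h) x = X.ρ g (X.ρ h x) := by
  rw [map_mul, Module.End.mul_apply]

noncomputable def braidEquiv (X Y : ZCat k G) : X.V ⊗[k] Y.V ≃ₗ[k] Y.V ⊗[k] X.V :=
  LinearEquiv.ofLinearMap (braidMap X Y) (braidInvMap X Y)
    (TensorProduct.ext (LinearMap.ext fun y => ext_grade fun f x hx => by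
      change braidMap X Y (braidInvMap X Y (y ⊗ₜ x)) = y ⊗ₜ x
      rw [braidInvMap_tmul Y hx, braidMap_tmul Y hx, ρ_ρ_inv]))
    (TensorProduct.ext (ext_grade fun f x hx => LinearMap.ext fun y => by
      change braidInvMap X Y (braidMap X Y (x ⊗ₜ y)) = x ⊗ₜ y
      rw [braidMap_tmul Y hx, braidInvMap_tmul Y hx, ρ_inv_ρ]))

noncomputable def braiding (X Y : ZCat k G) : X ⊗ Y ≅ Y ⊗ X :=
  isoMk (X := tensor X Y) (Y := tensor Y X) (braidEquiv X Y)
    (fun g v => by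
      refine LinearMap.congr_fun (f := braidMap X Y ∘ₗ X.ρ.tprod Y.ρ g)
        (g := Y.ρ.tprod X.ρ g ∘ₗ braidMap X Y) ?_ v
      refine TensorProduct.ext (ext_grade fun f x hx => LinearMap.ext fun y => ?_)
      change braidMap X Y (X.ρ g x ⊗ₜ Y.ρ g y) = Y.ρ.tprod X.ρ g (braidMap X Y (x ⊗ₜ y))
      rw [braidMap_tmul Y (ρ_mem hx g), braidMap_tmul Y hx, Representation.tprod_apply, map_tmul,
        ← ρ_mul, ← ρ_mul]
      congr 2
      group)
    (tensor_comm_pr (Z := tensor Y X) (T := braidMap X Y) (by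
      intro a x hx b y hy
      rw [braidMap_tmul Y hx]
      have := tmul_mem (ρ_mem hy a) hx
      rwa [inv_mul_cancel_right] at this))

theorem braiding_hom (X Y : ZCat k G) : (braiding X Y).hom.hom = braidMap X Y := rfl

noncomputable instance : BraidedCategory (ZCat k G) where
  braiding := braiding
  braiding_naturality_right X Y Z f := hom_ext _ _ (by
    refine TensorProduct.ext (ext_grade fun a x hx => LinearMap.ext fun y => ?_)
    change braidMap X Z (x ⊗ₜ f.hom y) = TensorProduct.map f.hom LinearMap.id (braidMap X Y (x ⊗ₜ y))
    rw [braidMap_tmul _ hx, braidMap_tmul _ hx, map_tmul, f.comm_ρ, LinearMap.id_apply])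
  braiding_naturality_left {X Y} f Z := hom_ext _ _ (by
    refine TensorProduct.ext (ext_grade fun a x hx => LinearMap.ext fun y => ?_)
    change braidMap Y Z (f.hom x ⊗ₜ y) = TensorProduct.map LinearMap.id f.hom (braidMap X Z (x ⊗ₜ y))
    rw [braidMap_tmul _ hx, braidMap_tmul _ (hom_mem f hx), map_tmul, LinearMap.id_apply])
  hexagon_forward X Y Z := hom_ext _ _ (by
    refine TensorProduct.ext (TensorProduct.ext (ext_grade fun a x hx => LinearMap.ext fun y =>
      LinearMap.ext fun z => ?_))
    change TensorProduct.assoc k Y.V Z.V X.V (braidMap X (tensor Y Z) (x ⊗ₜ (y ⊗ₜ z))) =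
      TensorProduct.map LinearMap.id (braidMap X Z) (TensorProduct.assoc k Y.V X.V Z.V
        (TensorProduct.map (braidMap X Y) LinearMap.id ((x ⊗ₜ y) ⊗ₜ z)))
    rw [braidMap_tmul (tensor Y Z) hx, map_tmul, braidMap_tmul Y hx, LinearMap.id_apply,
      TensorProduct.assoc_tmul, map_tmul, braidMap_tmul Z hx]
    rfl)
  hexagon_reverse X Y Z := hom_ext _ _ (by
    refine TensorProduct.ext (ext_grade fun a x hx => TensorProduct.ext (ext_grade fun b y hy =>
      LinearMap.ext fun z => ?_))
    change (TensorProduct.assoc k Z.V X.V Y.V).symm (braidMap (tensor X Y) Z ((x ⊗ₜ y) ⊗ₜ z)) =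
      TensorProduct.map (braidMap X Z) LinearMap.id ((TensorProduct.assoc k X.V Z.V Y.V).symm
        (TensorProduct.map LinearMap.id (braidMap Y Z) (x ⊗ₜ (y ⊗ₜ z))))
    rw [braidMap_tmul Z (tmul_mem hx hy), map_tmul, braidMap_tmul Z hy, LinearMap.id_apply,
      TensorProduct.assoc_symm_tmul, TensorProduct.assoc_symm_tmul, map_tmul, braidMap_tmul Z hx,
      ρ_mul]
    rfl)

end Braided

end ZCat

namespace ZCat
variable {k : Type u} [Field k] {G : Type u} [Group G] [Finite G]

section Rigid

open TensorProduct

/-- The dual object, with `(X^∨)_g = (X_{g⁻¹})^*` and the contragredient action. -/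
noncomputable abbrev dual (X : ZCat k G) : ZCat k G where
  V := Module.Dual k X.V
  ρ := X.ρ.dual
  pr g := (X.pr g⁻¹).dualMap
  pr_self g l := by
    ext v; exact congrArg l (X.pr_self g⁻¹ v)
  pr_ne g h l hgh := by
    ext v
    exact (congrArg l (X.pr_ne h⁻¹ g⁻¹ v fun e => hgh (inv_injective e).symm)).trans (map_zero l)
  sum_pr l := by
    ext v
    rw [LinearMap.sum_apply]
    change ∑ g, l (X.pr g⁻¹ v) = l v
    rw [← map_sum]
    congr 1
    exact (Equiv.sum_comp (Equiv.inv G) fun g => X.pr g v).trans (X.sum_pr v)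
  ρ_pr f g l := by
    ext v
    change l (X.pr g⁻¹ (X.ρ f⁻¹ v)) = l (X.ρ f⁻¹ (X.pr (f * g * f⁻¹)⁻¹ v))
    rw [X.ρ_pr]
    congr 3
    group

noncomputable def ev (X : ZCat k G) : dual X ⊗ X ⟶ 𝟙_ (ZCat k G) where
  hom := contractLeft k X.V
  comm_ρ g v := by
    refine LinearMap.congr_fun (f := contractLeft k X.V ∘ₗ X.ρ.dual.tprod X.ρ g)
      (g := contractLeft k X.V) (TensorProduct.ext' fun l x => ?_) v
    exact congrArg l (ρ_inv_ρ X g x)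
  comm_pr := tensor_comm_pr (X := dual X) (Y := X) (Z := unit) (T := contractLeft k X.V) (by
    intro a l hl b x hx
    by_cases h : a * b = 1
    · rw [h]; exact unit_mem _
    · have : l x = 0 := by
        rw [← mem_grade.1 hl]
        change l (X.pr a⁻¹ x) = 0
        rw [pr_of_mem hx, if_neg, map_zero]
        rintro rfl
        simp at h
      rw [contractLeft_apply, this]
      exact Submodule.zero_mem _)

/-- `V ⊗ V^*` as endomorphisms. -/
noncomputable def toEnd (W : Type u) [AddCommGroup W] [Module k W] [FiniteDimensional k W] :
    W ⊗[k] Module.Dual k W ≃ₗ[k] W →ₗ[k] W :=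
  TensorProduct.comm k W (Module.Dual k W) ≪≫ₗ dualTensorHomEquiv k W W

theorem toEnd_tmul {W : Type u} [AddCommGroup W] [Module k W] [FiniteDimensional k W]
    (w : W) (l : Module.Dual k W) (x : W) : toEnd (k := k) W (w ⊗ₜ l) x = l x • w := by
  simp [toEnd]

theorem toEnd_coev (W : Type u) [AddCommGroup W] [Module k W] [FiniteDimensional k W] :
    toEnd (k := k) W (coevaluation k W 1) = LinearMap.id := by
  ext x
  rw [coevaluation_apply_one, map_sum, LinearMap.sum_apply]
  simp only [toEnd_tmul]
  exact (Module.Basis.ofVectorSpace k W).sum_repr x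

theorem toEnd_map {W : Type u} [AddCommGroup W] [Module k W] [FiniteDimensional k W]
    (S T : W →ₗ[k] W) (t : W ⊗[k] Module.Dual k W) :
    toEnd (k := k) W (TensorProduct.map S T.dualMap t) = S ∘ₗ toEnd W t ∘ₗ T := by
  induction t with
  | zero => simp
  | add a b ha hb => simp only [map_add, ha, hb, LinearMap.add_comp, LinearMap.comp_add]
  | tmul w l => ext x; simp [toEnd_tmul]

noncomputable def coev (X : ZCat k G) : 𝟙_ (ZCat k G) ⟶ X ⊗ dual X where
  hom := coevaluation k X.V
  comm_ρ g r := by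
    refine LinearMap.congr_fun (f := coevaluation k X.V)
      (g := X.ρ.tprod X.ρ.dual g ∘ₗ coevaluation k X.V) (LinearMap.ext_ring ?_) r
    apply (toEnd (k := k) X.V).injective
    rw [LinearMap.comp_apply, toEnd_coev]
    refine Eq.trans ?_ (toEnd_map (X.ρ g) (X.ρ g⁻¹) _).symm
    rw [toEnd_coev]
    ext x
    exact (ρ_ρ_inv X g x).symm
  comm_pr g r := by
    classical
    refine LinearMap.congr_fun (f := coevaluation k X.V ∘ₗ (unit (k := k) (G := G)).pr g)
      (g := tensorPr X (dual X) g ∘ₗ coevaluation k X.V) (LinearMap.ext_ring ?_) r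
    apply (toEnd (k := k) X.V).injective
    rw [LinearMap.comp_apply, LinearMap.comp_apply, tensorPr, LinearMap.sum_apply, map_sum]
    rw [Finset.sum_congr rfl fun a _ => toEnd_map (X.pr a) (X.pr (a⁻¹ * g)⁻¹) _, toEnd_coev]
    refine ext_grade (X := X) fun b x hx => ?_
    rw [LinearMap.sum_apply]
    simp only [LinearMap.comp_apply, LinearMap.id_apply, pr_of_mem hx]
    rw [pr_of_mem (unit_mem (k := k) (G := G) (1 : k))]
    by_cases h : g = 1
    · subst h
      rw [if_pos rfl, toEnd_coev, Finset.sum_eq_single b]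
      · simp [mem_grade.1 hx]
      · intro c _ hc
        simp [hc]
      · simp
    · rw [if_neg h, map_zero, map_zero, Finset.sum_eq_zero]
      · simp
      · intro a _
        split_ifs with h1
        · rw [pr_of_mem hx, if_neg]
          rintro rfl
          apply h
          simpa using h1
        · simp

noncomputable instance (X : ZCat k G) : ExactPairing X (dual X) where
  coevaluation' := coev X
  evaluation' := ev X
  coevaluation_evaluation' := hom_ext _ _ (contractLeft_assoc_coevaluation k X.V)
  evaluation_coevaluation' := hom_ext _ _ (contractLeft_assoc_coevaluation' k X.V)

noncomputable instance (X : ZCat k G) : HasRightDual X := ⟨dual X⟩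

noncomputable instance : RightRigidCategory (ZCat k G) where

noncomputable instance : RigidCategory (ZCat k G) :=
  BraidedCategory.rigidCategoryOfRightRigidCategory

instance (X : ZCat k G) : PreservesColimitsOfSize.{0, 0} (tensorLeft X) :=
  (tensorLeftAdjunction (ᘁX) X).leftAdjoint_preservesColimits

instance (X : ZCat k G) : PreservesColimitsOfSize.{0, 0} (tensorRight X) :=
  (tensorRightAdjunction X Xᘁ).leftAdjoint_preservesColimits

/-- The linear map `x ↦ f⁻¹ x` for `x` of degree `f`. -/
noncomputable def twistMap (X : ZCat k G) : X.V →ₗ[k] X.V := ∑ f, X.ρ f⁻¹ ∘ₗ X.pr f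

theorem twistMap_of_mem {X : ZCat k G} {f : G} {x : X.V} (hx : x ∈ X.grade f) :
    twistMap X x = X.ρ f⁻¹ x := by
  rw [twistMap, LinearMap.sum_apply, Finset.sum_eq_single f]
  · simp [mem_grade.1 hx]
  · intro c _ hc
    simp [pr_of_mem hx, hc]
  · simp

theorem ρ_inv_mem {X : ZCat k G} {f : G} {x : X.V} (hx : x ∈ X.grade f) :
    X.ρ f⁻¹ x ∈ X.grade f := by
  have := ρ_mem hx f⁻¹
  simpa using this

theorem ρ_self_mem {X : ZCat k G} {f : G} {x : X.V} (hx : x ∈ X.grade f) :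
    X.ρ f x ∈ X.grade f := by
  have := ρ_mem hx f
  simpa using this

noncomputable def twistEquiv (X : ZCat k G) : X.V ≃ₗ[k] X.V :=
  LinearEquiv.ofLinearMap (twistMap X) (∑ f, X.ρ f ∘ₗ X.pr f)
    (ext_grade fun f x hx => by
      have : (∑ f, X.ρ f ∘ₗ X.pr f) x = X.ρ f x := by
        rw [LinearMap.sum_apply, Finset.sum_eq_single f]
        · simp [mem_grade.1 hx]
        · intro c _ hc
          simp [pr_of_mem hx, hc]
        · simp
      rw [LinearMap.comp_apply, this, twistMap_of_mem (ρ_self_mem hx), ρ_inv_ρ]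
      rfl)
    (ext_grade fun f x hx => by
      rw [LinearMap.comp_apply, twistMap_of_mem hx, LinearMap.sum_apply, Finset.sum_eq_single f]
      · simp [mem_grade.1 (ρ_inv_mem hx)]
      · intro c _ hc
        simp [pr_of_mem (ρ_inv_mem hx), hc]
      · simp)

/-- The ribbon twist `x ↦ f⁻¹ x` for `x` of degree `f`. -/
noncomputable def twistIso (X : ZCat k G) : X ≅ X :=
  isoMk (twistEquiv X)
    (fun g v => by
      refine LinearMap.congr_fun (f := twistMap X ∘ₗ X.ρ g) (g := X.ρ g ∘ₗ twistMap X)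
        (ext_grade fun f x hx => ?_) v
      rw [LinearMap.comp_apply, LinearMap.comp_apply, twistMap_of_mem hx,
        twistMap_of_mem (ρ_mem hx g), ← ρ_mul, ← ρ_mul]
      congr 2
      group)
    (comm_of_mem (T := twistMap X) fun f x hx => by
      rw [twistMap_of_mem hx]
      exact ρ_inv_mem hx)

theorem twistIso_natural {X Y : ZCat k G} (f : X ⟶ Y) :
    f ≫ (twistIso Y).hom = (twistIso X).hom ≫ f :=
  hom_ext _ _ (ext_grade fun g x hx => by
    change twistMap Y (f.hom x) = f.hom (twistMap X x)
    rw [twistMap_of_mem hx, twistMap_of_mem (hom_mem f hx), f.comm_ρ])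

theorem twistIso_tensor (X Y : ZCat k G) : (twistIso X).hom ⊗ₘ (twistIso Y).hom =
    (β_ X Y).hom ≫ (β_ Y X).hom ≫ (twistIso (X ⊗ Y)).hom :=
  hom_ext _ _ (tensor_ext fun a x hx b y hy => by
    change TensorProduct.map (twistMap X) (twistMap Y) (x ⊗ₜ y) =
      twistMap (tensor X Y) (braidMap Y X (braidMap X Y (x ⊗ₜ y)))
    rw [braidMap_tmul Y hx, braidMap_tmul X (ρ_mem hy a), map_tmul, twistMap_of_mem hx,
      twistMap_of_mem hy,
      twistMap_of_mem (tmul_mem (ρ_mem hx (a * b * a⁻¹)) (ρ_mem hy a))]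
    change _ = X.ρ _ (X.ρ _ _) ⊗ₜ Y.ρ _ (Y.ρ _ _)
    rw [← ρ_mul, ← ρ_mul]
    congr 3 <;> group)

theorem rightAdjointMate_hom {X Y : ZCat k G} (f : X ⟶ Y) : (fᘁ).hom = f.hom.dualMap := by
  refine LinearMap.ext fun l => LinearMap.ext fun x => ?_
  exact LinearMap.congr_fun (congrArg Hom.hom (rightAdjointMate_comp_evaluation f)) (l ⊗ₜ x)

theorem twistIso_dual (X : ZCat k G) : (twistIso Xᘁ).hom = ((twistIso X).hom)ᘁ := by
  refine hom_ext _ _ ?_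
  rw [rightAdjointMate_hom]
  refine ext_grade (X := dual X) fun a l hl => ext_grade fun b x hx => ?_
  change twistMap (dual X) l x = l (twistMap X x)
  rw [twistMap_of_mem hl, twistMap_of_mem hx]
  change l (X.ρ a⁻¹⁻¹ x) = _
  rw [inv_inv]
  have hl' : ∀ y, l y = l (X.pr a⁻¹ y) := fun y => (LinearMap.congr_fun (mem_grade.1 hl) y).symm
  by_cases h : b = a⁻¹
  · rw [h, inv_inv]
  · rw [hl', hl' (X.ρ b⁻¹ x), pr_of_mem (ρ_inv_mem hx), pr_of_mem (ρ_mem hx a), if_neg (Ne.symm h),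
      if_neg]
    intro e
    apply h
    have : a⁻¹ = a⁻¹ * (a * b * a⁻¹) * a := by rw [← e]; group
    rw [this]
    group

noncomputable instance : RibbonCategory (ZCat k G) where
  twist := NatIso.ofComponents twistIso twistIso_natural
  twist_tensor := twistIso_tensor
  twist_dual := twistIso_dual

end Rigid

section Coequalizer

variable {X Y : ZCat k G} (f g : X ⟶ Y)

theorem range_le_comap_ρ (a : G) : LinearMap.range (f.hom - g.hom) ≤
    (LinearMap.range (f.hom - g.hom)).comap (Y.ρ a) := by
  rintro _ ⟨x, rfl⟩
  exact ⟨X.ρ a x, by simp [f.comm_ρ, g.comm_ρ]⟩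

theorem range_le_comap_pr (a : G) : LinearMap.range (f.hom - g.hom) ≤
    (LinearMap.range (f.hom - g.hom)).comap (Y.pr a) := by
  rintro _ ⟨x, rfl⟩
  exact ⟨X.pr a x, by simp [f.comm_pr, g.comm_pr]⟩

/-- The coequalizer of two morphisms, as a quotient space. -/
noncomputable abbrev coeq : ZCat k G where
  V := Y.V ⧸ LinearMap.range (f.hom - g.hom)
  ρ := 
    { toFun := fun a => Submodule.mapQ _ _ (Y.ρ a) (range_le_comap_ρ f g a)
      map_one' := by ext v; simp
      map_mul' := fun a b => by ext v; simp }
  pr a := Submodule.mapQ _ _ (Y.pr a) (range_le_comap_pr f g a)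
  pr_self a v := by
    obtain ⟨v, rfl⟩ := Submodule.mkQ_surjective _ v
    simp [Y.pr_self]
  pr_ne a b v h := by
    obtain ⟨v, rfl⟩ := Submodule.mkQ_surjective _ v
    simp [Y.pr_ne a b v h]
  sum_pr v := by
    obtain ⟨v, rfl⟩ := Submodule.mkQ_surjective _ v
    simp only [Submodule.mkQ_apply, Submodule.mapQ_apply]
    rw [← Submodule.mkQ_apply]
    conv_rhs => rw [← Y.sum_pr v, map_sum]
    rfl
  ρ_pr a b v := by
    obtain ⟨v, rfl⟩ := Submodule.mkQ_surjective _ v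
    simp [Y.ρ_pr]

def coeqπ : Y ⟶ coeq f g where
  hom := Submodule.mkQ _
  comm_ρ _ _ := rfl
  comm_pr _ _ := rfl

instance : HasCoequalizers (ZCat k G) := by
  have h : ∀ {X Y : ZCat k G} {f g : X ⟶ Y}, HasColimit (parallelPair f g) := ?_
  · exact hasCoequalizers_of_hasColimit_parallelPair _
  intro X Y f g
  refine ⟨⟨Cofork.ofπ (coeqπ f g) ?_, Cofork.IsColimit.mk _ (fun s =>
    { hom := Submodule.liftQ _ s.π.hom ?_
      comm_ρ := ?_
      comm_pr := ?_ }) ?_ ?_⟩⟩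
  · ext x
    change Submodule.Quotient.mk (f.hom x) = Submodule.Quotient.mk (g.hom x)
    rw [Submodule.Quotient.eq]
    exact ⟨x, rfl⟩
  · rintro _ ⟨x, rfl⟩
    have h := LinearMap.congr_fun (congrArg Hom.hom s.condition) x
    rw [LinearMap.mem_ker, LinearMap.sub_apply, map_sub]
    exact sub_eq_zero.2 h
  · intro a v
    obtain ⟨v, rfl⟩ := Submodule.mkQ_surjective _ v
    exact s.π.comm_ρ a v
  · intro a v
    obtain ⟨v, rfl⟩ := Submodule.mkQ_surjective _ v
    exact s.π.comm_pr a v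
  · intro s
    exact hom_ext _ _ (LinearMap.ext fun v => rfl)
  · intro s m hm
    refine hom_ext _ _ (Submodule.linearMap_qext _ ?_)
    exact congrArg Hom.hom hm

end Coequalizer

end ZCat

open ZCat TensorProduct

section FunctionAlgebra

variable (k : Type u) [Field k] {G : Type u} [Group G] [Finite G] (H : Subgroup G)

/-- The action of `G` on functions on `G ⧸ H` by translation: `f p_x = p_{f x}`. -/
def funRep : Representation k G (G ⧸ H → k) where
  toFun f := LinearMap.funLeft k k (fun x : G ⧸ H => f⁻¹ • x)
  map_one' := by ext; simp [LinearMap.funLeft]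
  map_mul' f g := by ext; simp [LinearMap.funLeft, mul_smul]

@[simp] theorem funRep_apply (f : G) (a : G ⧸ H → k) (x : G ⧸ H) :
    funRep k H f a x = a (f⁻¹ • x) := rfl

open scoped Classical in
/-- The function algebra `k(G/H)` as an object of `𝒵(G)`, in trivial degree. -/
noncomputable abbrev funAlg : ZCat k G where
  V := G ⧸ H → k
  ρ := funRep k H
  pr g := if g = 1 then LinearMap.id else 0
  pr_self g v := by split_ifs <;> simp
  pr_ne g h v hgh := by
    by_cases h1 : g = 1
    · rw [if_neg (fun h2 => hgh (h1.trans h2.symm) : ¬ h = 1)]; simp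
    · rw [if_neg h1]; simp
  sum_pr v := by
    rw [Finset.sum_eq_single 1] <;> simp +contextual
  ρ_pr f g v := by
    by_cases h : g = 1
    · subst h; simp
    · have h' : ¬ f * g * f⁻¹ = 1 := by simpa using h
      rw [if_neg h, if_neg h']; simp

variable {k H}

theorem funAlg_mem (a : G ⧸ H → k) : a ∈ (funAlg k H).grade 1 := by
  rw [mem_grade]; simp

theorem funAlg_eq_zero {a : G ⧸ H → k} {g : G} (ha : a ∈ (funAlg k H).grade g) (hg : g ≠ 1) :
    a = 0 := by
  rw [← mem_grade.1 (funAlg_mem a), pr_of_mem ha, if_neg (Ne.symm hg)]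

noncomputable instance : MonObj (funAlg k H) where
  one :=
    { hom := Algebra.linearMap k (G ⧸ H → k)
      comm_ρ := fun _ _ => rfl
      comm_pr := fun g r => by
        refine (congrArg (Algebra.linearMap k (G ⧸ H → k))
          (pr_of_mem (unit_mem (G := G) r) g)).trans (Eq.trans ?_
            (pr_of_mem (funAlg_mem (H := H) (algebraMap k (G ⧸ H → k) r)) g).symm)
        split_ifs
        · rfl
        · exact map_zero _ }
  mul :=
    { hom := LinearMap.mul' k (G ⧸ H → k)
      comm_ρ := fun g v => LinearMap.congr_fun
        (f := LinearMap.mul' k (G ⧸ H → k) ∘ₗ (funRep k H).tprod (funRep k H) g)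
        (g := funRep k H g ∘ₗ LinearMap.mul' k (G ⧸ H → k)) (TensorProduct.ext' fun _ _ => rfl) v
      comm_pr := tensor_comm_pr (X := funAlg k H) (Y := funAlg k H) (Z := funAlg k H)
        (T := LinearMap.mul' k (G ⧸ H → k)) (by
          intro a x hx b y hy
          by_cases h1 : a = 1
          · by_cases h2 : b = 1
            · subst h1 h2
              rw [_root_.mul_one]
              exact funAlg_mem _
            · rw [funAlg_eq_zero hy h2, tmul_zero, map_zero]
              exact Submodule.zero_mem _
          · rw [funAlg_eq_zero hx h1, zero_tmul, map_zero]
            exact Submodule.zero_mem _) }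
  one_mul := hom_ext _ _ (TensorProduct.ext' fun r a => by
    exact (Algebra.smul_def r a).symm)
  mul_one := hom_ext _ _ (TensorProduct.ext' fun a r => by
    exact (Algebra.commutes r a).symm.trans (Algebra.smul_def r a).symm)
  mul_assoc := hom_ext _ _ (TensorProduct.ext_threefold fun a b c => _root_.mul_assoc a b c)

theorem funAlg_mul (a b : G ⧸ H → k) : (μ[funAlg k H]).hom (a ⊗ₜ b) = a * b := rfl

theorem funAlg_one (r : k) : (η[funAlg k H]).hom r = algebraMap k (G ⧸ H → k) r := rfl

instance : IsCommMonObj (funAlg k H) where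
  mul_comm := hom_ext _ _ (TensorProduct.ext' fun a b => by
    change LinearMap.mul' k _ (braidMap (funAlg k H) (funAlg k H) (a ⊗ₜ b)) = a * b
    rw [braidMap_tmul _ (funAlg_mem a), map_one]
    exact _root_.mul_comm b a)

end FunctionAlgebra

section Corner

variable {k : Type u} [Field k] {G : Type u} [Group G] [Finite G] {H : Subgroup G}

namespace RMod

/-- Right multiplication `m ↦ m a` on a right `k(G/H)`-module. -/
noncomputable def rmul (M : RMod (funAlg k H)) (a : G ⧸ H → k) : M.X.V →ₗ[k] M.X.V :=
  M.act.hom ∘ₗ (TensorProduct.mk k M.X.V (G ⧸ H → k)).flip a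

theorem rmul_apply (M : RMod (funAlg k H)) (a : G ⧸ H → k) (m : M.X.V) :
    rmul M a m = M.act.hom (m ⊗ₜ[k] a) := rfl

theorem rmul_rmul (M : RMod (funAlg k H)) (a b : G ⧸ H → k) (m : M.X.V) :
    rmul M b (rmul M a m) = rmul M (a * b) m :=
  (LinearMap.congr_fun (congrArg ZCat.Hom.hom M.act_mul) (m ⊗ₜ (a ⊗ₜ b))).symm

theorem rmul_zero (M : RMod (funAlg k H)) (m : M.X.V) : rmul M 0 m = 0 := by
  rw [rmul_apply, tmul_zero, map_zero]

theorem ρ_rmul (M : RMod (funAlg k H)) (g : G) (a : G ⧸ H → k) (m : M.X.V) :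
    M.X.ρ g (rmul M a m) = rmul M (funRep k H g a) (M.X.ρ g m) :=
  (M.act.comm_ρ g (m ⊗ₜ a)).symm

theorem rmul_mem (M : RMod (funAlg k H)) {g : G} {m : M.X.V} (hm : m ∈ M.X.grade g)
    (a : G ⧸ H → k) : rmul M a m ∈ M.X.grade g := by
  have := hom_mem M.act (tmul_mem hm (funAlg_mem a))
  rwa [_root_.mul_one] at this

theorem pr_rmul (M : RMod (funAlg k H)) (g : G) (a : G ⧸ H → k) (m : M.X.V) :
    M.X.pr g (rmul M a m) = rmul M a (M.X.pr g m) :=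
  (comm_of_mem (X := M.X) (Y := M.X) (T := rmul M a) (fun _ _ hm => rmul_mem M hm a) g m).symm

theorem rmul_local {M : RMod (funAlg k H)} (hM : IsLocal M) {g : G} {m : M.X.V}
    (hm : m ∈ M.X.grade g) (a : G ⧸ H → k) : rmul M (funRep k H g a) m = rmul M a m := by
  have h := LinearMap.congr_fun (congrArg ZCat.Hom.hom hM) (m ⊗ₜ a)
  change M.act.hom (braidMap (funAlg k H) M.X (braidMap M.X (funAlg k H) (m ⊗ₜ a))) =
    M.act.hom (m ⊗ₜ a) at h
  rw [braidMap_tmul _ hm, braidMap_tmul _ (funAlg_mem _), map_one] at h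
  exact h

end RMod

open scoped Classical in
variable (k H) in
/-- The minimal idempotent `p` of `k(G/H)` supported at the trivial coset; its stabiliser
is `H`. -/
noncomputable def idem : G ⧸ H → k := Pi.single ((1 : G) : G ⧸ H) 1

theorem idem_mul_idem : idem k H * idem k H = idem k H := by
  classical
  rw [idem, ← Pi.single_mul]; simp

theorem funRep_idem (g : G) (x : G ⧸ H) [Decidable (x = (g : G ⧸ H))] :
    funRep k H g (idem k H) x = if x = (g : G ⧸ H) then 1 else 0 := by
  classical
  rw [funRep_apply, idem, Pi.single_apply]
  have : g⁻¹ • x = ((1 : G) : G ⧸ H) ↔ x = (g : G ⧸ H) := by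
    rw [inv_smul_eq_iff]
    simp
  simp only [this]

theorem funRep_idem_of_mem {g : G} (hg : g ∈ H) : funRep k H g (idem k H) = idem k H := by
  classical
  ext x
  rw [funRep_idem, idem, Pi.single_apply]
  have : (g : G ⧸ H) = ((1 : G) : G ⧸ H) := by
    rw [QuotientGroup.eq]; simpa using hg
  rw [this]

theorem idem_mul_of_notMem {g : G} (hg : g ∉ H) : idem k H * funRep k H g (idem k H) = 0 := by
  classical
  ext x
  rw [Pi.mul_apply, funRep_idem, idem, Pi.single_apply]
  split_ifs with h1 h2
  · exfalso
    apply hg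
    have := QuotientGroup.eq.1 (h1.symm.trans h2)
    simpa using this
  all_goals simp

/-- A local module multiplied by `p` is supported on `H`. -/
theorem pr_rmul_idem_of_notMem {M : RMod (funAlg k H)} (hM : RMod.IsLocal M) {g : G} (hg : g ∉ H)
    (m : M.X.V) : M.X.pr g (M.rmul (idem k H) m) = 0 := by
  rw [RMod.pr_rmul, ← idem_mul_idem, ← RMod.rmul_rmul,
    ← RMod.rmul_local hM (RMod.rmul_mem M (M.X.pr_mem g m) _), RMod.rmul_rmul,
    idem_mul_of_notMem hg, RMod.rmul_zero]

/-- The object `M p` of `𝒵(H)`. -/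
noncomputable abbrev cornerObj (M : LocMod (funAlg k H)) : ZCat k H where
  V := LinearMap.range (M.obj.rmul (idem k H))
  ρ :=
    { toFun := fun h => (M.obj.X.ρ h).restrict (by
        rintro _ ⟨m, rfl⟩
        exact ⟨M.obj.X.ρ h m, by rw [RMod.ρ_rmul, funRep_idem_of_mem h.2]⟩)
      map_one' := by
        ext v
        exact LinearMap.congr_fun (map_one M.obj.X.ρ) (v : M.obj.X.V)
      map_mul' := fun a b => by
        ext v
        exact LinearMap.congr_fun (map_mul M.obj.X.ρ (a : G) b) (v : M.obj.X.V) }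
  pr h := (M.obj.X.pr h).restrict (by
    rintro _ ⟨m, rfl⟩
    exact ⟨M.obj.X.pr h m, by rw [RMod.pr_rmul]⟩)
  pr_self g v := Subtype.ext (M.obj.X.pr_self g v)
  pr_ne g h v hgh := Subtype.ext (M.obj.X.pr_ne g h v fun e => hgh (Subtype.ext e))
  sum_pr v := by
    obtain ⟨_, m, rfl⟩ := v
    apply Subtype.ext
    rw [AddSubmonoidClass.coe_finsetSum]
    refine Eq.trans ?_ (M.obj.X.sum_pr (M.obj.rmul (idem k H) m))
    classical
    refine (Finset.sum_subtype (F := Fintype.ofFinite H) (Finset.univ.filter (· ∈ H)) (by simp)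
      (fun g => M.obj.X.pr g (M.obj.rmul (idem k H) m))).symm.trans ?_
    refine Finset.sum_subset (Finset.subset_univ _) fun g _ hg => ?_
    exact pr_rmul_idem_of_notMem M.property (by simpa using hg) m
  ρ_pr f g v := Subtype.ext (M.obj.X.ρ_pr f g v)

variable (k H) in
/-- The functor `M ↦ M p` from local `k(G/H)`-modules to `𝒵(H)`. -/
noncomputable def cornerFunctor : LocMod (funAlg k H) ⥤ ZCat k H where
  obj := cornerObj
  map {M N} f :=
    { hom := (f.hom.hom.hom).restrict (by
        rintro _ ⟨m, rfl⟩
        exact ⟨f.hom.hom.hom m, (LinearMap.congr_fun (congrArg ZCat.Hom.hom f.hom.act_hom)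
          (m ⊗ₜ idem k H)).symm⟩)
      comm_ρ := fun h v => Subtype.ext (f.hom.hom.comm_ρ h v)
      comm_pr := fun h v => Subtype.ext (f.hom.hom.comm_pr h v) }
  map_id _ := rfl
  map_comp _ _ := rfl

end Corner

section Induction

variable {k : Type u} [Field k] {G : Type u} [Group G] [Finite G] {H : Subgroup G}

open scoped Classical in
/-- The delta function `p_g` in the function algebra `k(G)`. -/
noncomputable def delta (k : Type u) [Field k] {G : Type u} (g : G) : G → k := Pi.single g 1

/-- The relations `p_{g h} ⊗ u = p_g ⊗ h u`. -/
def indRel (U : ZCat k H) : Submodule k ((G → k) ⊗[k] U.V) :=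
  Submodule.span k {t | ∃ (g : G) (h : H) (u : U.V),
    t = delta k (g * h) ⊗ₜ u - delta k g ⊗ₜ U.ρ h u}

/-- The vector space `k(G) ⊗_H U`. -/
abbrev IndV (U : ZCat k H) : Type u := ((G → k) ⊗[k] U.V) ⧸ indRel U

/-- The element `p_g ⊗ u`. -/
noncomputable def indMk (U : ZCat k H) (g : G) (u : U.V) : IndV U :=
  (indRel U).mkQ (delta k g ⊗ₜ u)

theorem ind_ext {U : ZCat k H} {W : Type*} [AddCommGroup W] [Module k W] {S T : IndV U →ₗ[k] W}
    (h : ∀ (g : G) (b : H), ∀ u ∈ U.grade b, S (indMk U g u) = T (indMk U g u)) : S = T := by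
  classical
  refine Submodule.linearMap_qext _ (TensorProduct.ext ?_)
  refine LinearMap.pi_ext' fun g => LinearMap.ext_ring (ext_grade fun b u hu => ?_)
  have := h g b u hu
  rw [indMk, delta] at this
  change S ((indRel U).mkQ (Pi.single g 1 ⊗ₜ u)) = T ((indRel U).mkQ (Pi.single g 1 ⊗ₜ u))
  convert this

theorem indMk_mul (U : ZCat k H) (g : G) (h : H) (u : U.V) :
    indMk U (g * h) u = indMk U g (U.ρ h u) := by
  rw [indMk, indMk, ← sub_eq_zero, ← map_sub, Submodule.mkQ_apply, Submodule.Quotient.mk_eq_zero]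
  exact Submodule.subset_span ⟨g, h, u, rfl⟩

theorem indRel_le_ker {U : ZCat k H} {W : Type*} [AddCommGroup W] [Module k W]
    (T : (G → k) ⊗[k] U.V →ₗ[k] W)
    (h : ∀ (g : G) (h : H) (u : U.V), T (delta k (g * h) ⊗ₜ u) = T (delta k g ⊗ₜ U.ρ h u)) :
    indRel U ≤ LinearMap.ker T := by
  rw [indRel, Submodule.span_le]
  rintro _ ⟨g, a, u, rfl⟩
  rw [SetLike.mem_coe, LinearMap.mem_ker, map_sub, h, sub_self]

/-- The translation `p_g ↦ p_{f g}`. -/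
def translate (k : Type u) [Field k] (f : G) : (G → k) →ₗ[k] (G → k) :=
  LinearMap.funLeft k k (fun g => f⁻¹ * g)

theorem translate_delta (f g : G) : translate k f (delta k g) = delta k (f * g) := by
  classical
  ext x
  simp only [translate, LinearMap.funLeft_apply, delta, Pi.single_apply, inv_mul_eq_iff_eq_mul]

open scoped Classical in
/-- The map `p_g ↦ p_g` if `g h g⁻¹ = f` and `p_g ↦ 0` otherwise. -/
noncomputable def select (k : Type u) [Field k] (f : G) (h : G) : (G → k) →ₗ[k] (G → k) :=
  LinearMap.pi fun g => if g * h * g⁻¹ = f then LinearMap.proj g else 0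

open scoped Classical in
theorem select_delta (f h g : G) :
    select k f h (delta k g) = if g * h * g⁻¹ = f then delta k g else 0 := by
  ext x
  simp only [select, LinearMap.pi_apply, delta]
  by_cases hx : x = g
  · subst hx; split_ifs <;> simp
  · split_ifs <;> simp [hx]

/-- The action `f (p_g ⊗ u) = p_{f g} ⊗ u`. -/
noncomputable def indρ (U : ZCat k H) (f : G) : IndV U →ₗ[k] IndV U :=
  (indRel U).liftQ ((indRel U).mkQ ∘ₗ TensorProduct.map (translate k f) LinearMap.id)
    (indRel_le_ker _ fun g h u => by
      simp only [LinearMap.comp_apply, map_tmul, translate_delta, LinearMap.id_apply]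
      rw [← _root_.mul_assoc]
      exact indMk_mul U (f * g) h u)

theorem indρ_mk (U : ZCat k H) (f g : G) (u : U.V) :
    indρ U f (indMk U g u) = indMk U (f * g) u := by
  change (indRel U).mkQ (TensorProduct.map (translate k f) LinearMap.id (delta k g ⊗ₜ u)) = _
  rw [map_tmul, translate_delta]
  rfl

/-- The projections of the grading `|p_g ⊗ u| = g |u| g⁻¹`, before passing to the quotient. -/
noncomputable def indPrAux (U : ZCat k H) (f : G) : (G → k) ⊗[k] U.V →ₗ[k] (G → k) ⊗[k] U.V :=
  ∑ h : H, TensorProduct.map (select k f h) (U.pr h)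

open scoped Classical in
theorem indPrAux_tmul (U : ZCat k H) (f g : G) {h : H} {u : U.V} (hu : u ∈ U.grade h) :
    indPrAux U f (delta k g ⊗ₜ u) = if g * h * g⁻¹ = f then delta k g ⊗ₜ u else 0 := by
  rw [indPrAux, LinearMap.sum_apply, Finset.sum_eq_single h]
  · rw [map_tmul, select_delta, mem_grade.1 hu]
    split_ifs <;> simp
  · intro c _ hc
    rw [map_tmul, pr_of_mem hu, if_neg hc, tmul_zero]
  · simp

/-- The projections of the grading `|p_g ⊗ u| = g |u| g⁻¹`. -/
noncomputable def indPr (U : ZCat k H) (f : G) : IndV U →ₗ[k] IndV U :=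
  (indRel U).liftQ ((indRel U).mkQ ∘ₗ indPrAux U f)
    (indRel_le_ker _ fun g h u => by
      refine LinearMap.congr_fun
        (f := (indRel U).mkQ ∘ₗ indPrAux U f ∘ₗ TensorProduct.mk k _ _ (delta k (g * h)))
        (g := (indRel U).mkQ ∘ₗ indPrAux U f ∘ₗ TensorProduct.mk k _ _ (delta k g) ∘ₗ U.ρ h)
        (ext_grade fun b u hu => ?_) u
      change (indRel U).mkQ (indPrAux U f (delta k (g * h) ⊗ₜ u)) =
        (indRel U).mkQ (indPrAux U f (delta k g ⊗ₜ U.ρ h u))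
      rw [indPrAux_tmul U f _ hu, indPrAux_tmul U f _ (ρ_mem hu h)]
      have e : g * ↑h * ↑b * (g * ↑h)⁻¹ = g * ↑(h * b * h⁻¹) * g⁻¹ := by
        push_cast; group
      rw [e]
      split_ifs
      · exact indMk_mul U g h u
      · simp)

open scoped Classical in
theorem indPr_mk (U : ZCat k H) (f g : G) {h : H} {u : U.V} (hu : u ∈ U.grade h) :
    indPr U f (indMk U g u) = if g * h * g⁻¹ = f then indMk U g u else 0 := by
  change (indRel U).mkQ (indPrAux U f (delta k g ⊗ₜ u)) = _
  rw [indPrAux_tmul U f g hu]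
  split_ifs
  · rfl
  · simp

/-- The object `k(G) ⊗_H U` of `𝒵(G)`. -/
noncomputable abbrev indZ (U : ZCat k H) : ZCat k G where
  V := IndV U
  ρ :=
    { toFun := indρ U
      map_one' := ind_ext fun g b u _ => by
        rw [indρ_mk, _root_.one_mul]; rfl
      map_mul' := fun f f' => ind_ext fun g b u _ => by
        rw [Module.End.mul_apply, indρ_mk, indρ_mk, indρ_mk, _root_.mul_assoc] }
  pr := indPr U
  pr_self f v := by
    refine LinearMap.congr_fun (f := indPr U f ∘ₗ indPr U f) (g := indPr U f)
      (ind_ext fun g b u hu => ?_) v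
    rw [LinearMap.comp_apply, indPr_mk U f g hu]
    split_ifs with h
    · rw [indPr_mk U f g hu, if_pos h]
    · simp
  pr_ne f f' v hf := by
    refine LinearMap.congr_fun (f := indPr U f ∘ₗ indPr U f') (g := 0)
      (ind_ext fun g b u hu => ?_) v
    rw [LinearMap.comp_apply, indPr_mk U f' g hu]
    split_ifs with h
    · rw [indPr_mk U f g hu, if_neg (fun e => hf (e.symm.trans h))]; rfl
    · simp
  sum_pr v := by
    classical
    have := LinearMap.congr_fun (f := ∑ f, indPr U f) (g := LinearMap.id)
      (ind_ext fun g b u hu => ?_) v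
    · rwa [LinearMap.sum_apply] at this
    rw [LinearMap.sum_apply, Finset.sum_congr rfl fun f _ => indPr_mk U f g hu]
    simp
  ρ_pr f f' v := by
    refine LinearMap.congr_fun (f := indρ U f ∘ₗ indPr U f')
      (g := indPr U (f * f' * f⁻¹) ∘ₗ indρ U f) (ind_ext fun g b u hu => ?_) v
    rw [LinearMap.comp_apply, LinearMap.comp_apply, indPr_mk U f' g hu, indρ_mk,
      indPr_mk U _ _ hu]
    have e : f * g * ↑b * (f * g)⁻¹ = f * (g * ↑b * g⁻¹) * f⁻¹ := by group
    rw [e]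
    by_cases h : g * ↑b * g⁻¹ = f'
    · rw [if_pos h, if_pos (by rw [h]), indρ_mk]
    · rw [if_neg h, if_neg (by simpa using h), map_zero]

theorem mulRight_delta (a : G → k) (g : G) :
    LinearMap.mulRight k a (delta k g) = a g • delta k g := by
  classical
  ext x
  simp only [LinearMap.mulRight_apply, Pi.mul_apply, Pi.smul_apply, delta, Pi.single_apply]
  split_ifs with h
  · subst h; simp
  · simp

/-- Multiplication by the pullback of a function on `G ⧸ H` along the quotient map:
`(p_g ⊗ u) a = a(gH) p_g ⊗ u`. -/
noncomputable def indMul (U : ZCat k H) (a : G ⧸ H → k) : IndV U →ₗ[k] IndV U :=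
  (indRel U).liftQ ((indRel U).mkQ ∘ₗ TensorProduct.map
      (LinearMap.mulRight k (fun g : G => a (g : G ⧸ H))) LinearMap.id)
    (indRel_le_ker _ fun g h u => by
      have e : ((g * h : G) : G ⧸ H) = g := by
        rw [QuotientGroup.eq]; simp
      simp only [LinearMap.comp_apply, map_tmul, LinearMap.id_apply, mulRight_delta,
        ← smul_tmul', map_smul, e]
      congr 1
      exact indMk_mul U g h u)

theorem indMul_mk (U : ZCat k H) (a : G ⧸ H → k) (g : G) (u : U.V) :
    indMul U a (indMk U g u) = a (g : G ⧸ H) • indMk U g u := by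
  change (indRel U).mkQ (TensorProduct.map (LinearMap.mulRight k (fun g : G => a (g : G ⧸ H)))
    LinearMap.id (delta k g ⊗ₜ u)) = _
  rw [map_tmul, mulRight_delta, ← smul_tmul', map_smul]
  rfl

/-- The right action of `k(G/H)` on `k(G) ⊗_H U` as a linear map. -/
noncomputable def indActMap (U : ZCat k H) : IndV U ⊗[k] (G ⧸ H → k) →ₗ[k] IndV U :=
  TensorProduct.lift (LinearMap.flip
    { toFun := indMul U
      map_add' := fun a b => ind_ext fun g _ u _ => by
        rw [LinearMap.add_apply, indMul_mk, indMul_mk, indMul_mk, Pi.add_apply, add_smul]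
      map_smul' := fun r a => ind_ext fun g _ u _ => by
        rw [LinearMap.smul_apply, indMul_mk, indMul_mk, Pi.smul_apply, smul_assoc]
        rfl })

theorem indActMap_tmul (U : ZCat k H) (a : G ⧸ H → k) (v : IndV U) :
    indActMap U (v ⊗ₜ a) = indMul U a v := rfl

theorem indMul_mem {U : ZCat k H} {f : G} {v : IndV U} (hv : v ∈ (indZ U).grade f)
    (a : G ⧸ H → k) : indMul U a v ∈ (indZ U).grade f := by
  classical
  rw [mem_grade] at hv ⊢
  conv_rhs => rw [← hv]
  refine LinearMap.congr_fun (f := indPr U f ∘ₗ indMul U a) (g := indMul U a ∘ₗ indPr U f)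
    (ind_ext fun g b u hu => ?_) v
  rw [LinearMap.comp_apply, LinearMap.comp_apply, indMul_mk, map_smul, indPr_mk U f g hu]
  split_ifs
  · rw [indMul_mk]
  · simp

noncomputable def indAct (U : ZCat k H) : indZ U ⊗ funAlg k H ⟶ indZ U where
  hom := indActMap U
  comm_ρ f v := LinearMap.congr_fun
    (f := indActMap U ∘ₗ TensorProduct.map (indρ U f) (funRep k H f))
    (g := indρ U f ∘ₗ indActMap U) (TensorProduct.ext (ind_ext fun g b u _ =>
      LinearMap.ext fun a => by
        change indMul U (funRep k H f a) (indρ U f (indMk U g u)) =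
          indρ U f (indMul U a (indMk U g u))
        rw [indρ_mk, indMul_mk, indMul_mk, map_smul, indρ_mk, funRep_apply]
        congr 2
        change ((f⁻¹ * (f * g) : G) : G ⧸ H) = g
        rw [inv_mul_cancel_left])) v
  comm_pr := tensor_comm_pr (X := indZ U) (Y := funAlg k H) (Z := indZ U) (T := indActMap U) (by
    intro f v hv b a ha
    by_cases hb : b = 1
    · subst hb
      rw [_root_.mul_one, indActMap_tmul]
      exact indMul_mem hv a
    · rw [funAlg_eq_zero ha hb, tmul_zero, map_zero]
      exact Submodule.zero_mem _)

/-- The right `k(G/H)`-module `k(G) ⊗_H U`. -/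
noncomputable def indMod (U : ZCat k H) : RMod (funAlg k H) where
  X := indZ U
  act := indAct U
  act_one := hom_ext _ _ (TensorProduct.ext (ind_ext fun g b u _ => LinearMap.ext_ring (by
    change indMul U (algebraMap k (G ⧸ H → k) 1) (indMk U g u) = (1 : k) • indMk U g u
    rw [indMul_mk]
    simp)))
  act_mul := hom_ext _ _ (TensorProduct.ext (ind_ext fun g c u _ => TensorProduct.ext'
    fun a b => by
      change indMul U (a * b) (indMk U g u) = indMul U b (indMul U a (indMk U g u))
      rw [indMul_mk, indMul_mk, map_smul, indMul_mk, smul_smul, Pi.mul_apply]))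

theorem indMod_isLocal (U : ZCat k H) : RMod.IsLocal (indMod U) := by
  refine hom_ext _ _ (TensorProduct.ext (ind_ext fun g c u hu => LinearMap.ext fun a => ?_))
  have hm : indMk U g u ∈ (indZ U).grade (g * c * g⁻¹) := by
    classical
    rw [mem_grade]
    exact (indPr_mk U _ g hu).trans (if_pos rfl)
  change indActMap U (braidMap (funAlg k H) (indZ U) (braidMap (indZ U) (funAlg k H)
    (indMk U g u ⊗ₜ a))) = indActMap U (indMk U g u ⊗ₜ a)
  rw [braidMap_tmul _ hm, braidMap_tmul _ (funAlg_mem _), map_one]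
  change indMul U (funRep k H _ a) (indMk U g u) = indMul U a (indMk U g u)
  rw [indMul_mk, indMul_mk, funRep_apply]
  congr 2
  change (((g * c * g⁻¹)⁻¹ * g : G) : G ⧸ H) = g
  rw [QuotientGroup.eq]
  simp [_root_.mul_assoc]

/-- The map `p_g ⊗ u ↦ p_g ⊗ f u`. -/
noncomputable def indMap {U W : ZCat k H} (f : U ⟶ W) : IndV U →ₗ[k] IndV W :=
  (indRel U).liftQ ((indRel W).mkQ ∘ₗ TensorProduct.map LinearMap.id f.hom)
    (indRel_le_ker _ fun g h u => by
      simp only [LinearMap.comp_apply, map_tmul, LinearMap.id_apply, f.comm_ρ]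
      exact indMk_mul W g h (f.hom u))

theorem indMap_mk {U W : ZCat k H} (f : U ⟶ W) (g : G) (u : U.V) :
    indMap f (indMk U g u) = indMk W g (f.hom u) := rfl

variable (k H) in
/-- The functor `U ↦ k(G) ⊗_H U` from `𝒵(H)` to local `k(G/H)`-modules. -/
noncomputable def indFunctor : ZCat k H ⥤ LocMod (funAlg k H) where
  obj U := ⟨indMod U, indMod_isLocal U⟩
  map {U W} f := ObjectProperty.homMk
    { hom :=
        { hom := indMap f
          comm_ρ := fun a v => LinearMap.congr_fun (f := indMap f ∘ₗ indρ U a)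
            (g := indρ W a ∘ₗ indMap f) (ind_ext fun g b u _ => by
              rw [LinearMap.comp_apply, LinearMap.comp_apply, indρ_mk, indMap_mk, indMap_mk,
                indρ_mk]) v
          comm_pr := fun a v => LinearMap.congr_fun (f := indMap f ∘ₗ indPr U a)
            (g := indPr W a ∘ₗ indMap f) (ind_ext fun g b u hu => by
              classical
              rw [LinearMap.comp_apply, LinearMap.comp_apply, indPr_mk U a g hu, indMap_mk,
                indPr_mk W a g (hom_mem f hu)]
              split_ifs
              · rw [indMap_mk]
              · simp) v }
      act_hom := hom_ext _ _ (TensorProduct.ext (ind_ext fun g b u _ => LinearMap.ext fun a => by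
        change indMap f (indMul U a (indMk U g u)) = indMul W a (indMap f (indMk U g u))
        rw [indMul_mk, map_smul, indMap_mk, indMul_mk])) }
  map_id U := ObjectProperty.hom_ext _ (RMod.hom_ext _ _ (hom_ext _ _ (ind_ext fun _ _ _ _ => rfl)))
  map_comp _ _ := ObjectProperty.hom_ext _
    (RMod.hom_ext _ _ (hom_ext _ _ (ind_ext fun _ _ _ _ => rfl)))

end Induction

end LocalModules

open LocalModules

/-! A module `M` over `k(G/H)` is a family of fibres `M p_x` over `G/H`, permuted by `G` compatibly
with its transitive action on cosets. It is therefore determined by the fibre `Mp` over the trivial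
coset with its action of the stabilizer `H`, and it is recovered from that fibre by induction.
Locality says that `m(ga) = ma` for `m` of degree `g`, so a nonzero homogeneous element of `M p_x`
has degree fixing `x`. In particular `Mp` lives in degrees belonging to `H`, which makes it an
object of `𝒵(H)`.

The two comparison maps are explicit. `cornerIndEquiv` identifies `U` with `p_1 ⊗ U`, and
`indCornerEquiv` reassembles `M` from the translates of `Mp`, using that the `p_x` sum to `1`
(`indCornerMap_inv`) and that distinct translates of `p` are orthogonal (`toCorner_ρ_of_notMem`).

In `M ⊗_A N` the idempotent can be moved between the factors and duplicated, and `A` acts on a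
corner by the scalars `a ↦ a(H)`. Hence `(M ⊗_A N)p` is `Mp ⊗ Np` over `k` (`cornerMul_bijective`).
On such elements the associator, the unitors, the braiding and the twist of local modules are given
by the same formulas as in `𝒵(H)`, which yields a braided functor preserving twists.

The twist of `𝒵(G)` is `A`-linear on local modules by locality (`act_twistIso`), and its balancing
identity descends along the epimorphism `M ⊗ N ⟶ M ⊗_A N`. Duals are transported from `𝒵(H)`. For
the self-duality of the twist the transported duals need not be computed, because the twist is
self-adjoint for every pairing into the unit (`twistIso_pairing`, `locTwistIso_pairing`).
Separability is witnessed by the form `a ↦ ∑ a(x)` and the copairing `∑ p_x ⊗ p_x`. -/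

namespace LocalModules

open ZCat TensorProduct

attribute [local instance] Fintype.ofFinite

/-! ### Separability of the function algebra. -/

section Separable

variable {k : Type u} [Field k] {G : Type u} [Group G] [Finite G]

theorem ZCat.eq_zero_of_mem_unit {g : G} {r : k} (hr : r ∈ (ZCat.unit (k := k) (G := G)).grade g)
    (hg : g ≠ 1) : r = 0 := by
  rw [← mem_grade.1 (unit_mem (k := k) (G := G) r), pr_of_mem hr, if_neg (Ne.symm hg)]

variable (k) (H : Subgroup G)

open scoped Classical in
theorem funRep_single (f : G) (x : G ⧸ H) :
    funRep k H f (Pi.single x 1) = Pi.single (f • x) 1 := by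
  ext y
  simp only [funRep_apply, Pi.single_apply, inv_smul_eq_iff]

/-- The form `a ↦ ∑ x, a x` on `k(G/H)`. -/
noncomputable def sumForm : funAlg k H ⟶ 𝟙_ (ZCat k G) where
  hom := ∑ x, LinearMap.proj x
  comm_ρ f a := by
    change (∑ x, LinearMap.proj x) (funRep k H f a) = (∑ x, LinearMap.proj x) a
    simp only [LinearMap.sum_apply, LinearMap.proj_apply, funRep_apply]
    exact Equiv.sum_comp (MulAction.toPerm f⁻¹) a
  comm_pr := comm_of_mem (X := funAlg k H) (Y := ZCat.unit) (T := ∑ x, LinearMap.proj x)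
    fun g a ha => by
      by_cases hg : g = 1
      · subst hg; exact unit_mem _
      · rw [funAlg_eq_zero ha hg, map_zero]; exact Submodule.zero_mem _

theorem sumForm_hom (a : G ⧸ H → k) : (sumForm k H).hom a = ∑ x, a x :=
  LinearMap.sum_apply _ _ _

open scoped Classical in
/-- The copairing `∑ x, p_x ⊗ p_x`. -/
noncomputable def casimir : (G ⧸ H → k) ⊗[k] (G ⧸ H → k) :=
  ∑ x : G ⧸ H, Pi.single x 1 ⊗ₜ Pi.single x 1

/-- An element of `G` permutes the idempotents `p_x`, so it only reindexes the sum. -/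
theorem casimir_invariant (f : G) :
    TensorProduct.map (funRep k H f) (funRep k H f) (casimir k H) = casimir k H := by
  classical
  simp only [casimir, map_sum, map_tmul, funRep_single]
  exact Equiv.sum_comp (MulAction.toPerm f)
    (fun x : G ⧸ H => (Pi.single x 1 ⊗ₜ Pi.single x 1 : (G ⧸ H → k) ⊗[k] (G ⧸ H → k)))

theorem casimir_mem : casimir k H ∈ (ZCat.tensor (funAlg k H) (funAlg k H)).grade 1 := by
  classical
  refine Submodule.sum_mem _ fun x _ => ?_
  have := tmul_mem (funAlg_mem (k := k) (H := H) (Pi.single x 1))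
    (funAlg_mem (k := k) (H := H) (Pi.single x 1))
  rwa [_root_.mul_one] at this

/-- A map out of the unit object is an invariant vector of degree `1`; the vector here is `casimir`.
-/
noncomputable def copairing : 𝟙_ (ZCat k G) ⟶ funAlg k H ⊗ funAlg k H where
  hom := LinearMap.toSpanSingleton k _ (casimir k H)
  comm_ρ f r := by
    change r • casimir k H =
      TensorProduct.map (funRep k H f) (funRep k H f) (r • casimir k H)
    rw [map_smul, casimir_invariant]
  comm_pr := comm_of_mem (X := ZCat.unit) (Y := ZCat.tensor (funAlg k H) (funAlg k H))
    (T := LinearMap.toSpanSingleton k _ (casimir k H)) fun g r hr => by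
      by_cases hg : g = 1
      · subst hg
        exact Submodule.smul_mem _ r (casimir_mem k H)
      · rw [eq_zero_of_mem_unit hr hg, map_zero]; exact Submodule.zero_mem _

/-- The zigzag composite as pure linear algebra, kept apart from the categorical structure of
`𝒵(G)`. The next lemma treats the other zigzag. -/
theorem lid_map_assoc_symm_sum {W I : Type*} [AddCommGroup W] [Module k W] [Fintype I]
    (F : W ⊗[k] W →ₗ[k] k) (a : W) (e : I → W) :
    TensorProduct.lid k W (TensorProduct.map F LinearMap.id
      ((TensorProduct.assoc k W W W).symm (a ⊗ₜ (∑ i, e i ⊗ₜ e i)))) =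
      ∑ i, F (a ⊗ₜ e i) • e i := by
  simp only [tmul_sum, map_sum, TensorProduct.assoc_symm_tmul, map_tmul, TensorProduct.lid_tmul,
    LinearMap.id_apply]

theorem rid_map_assoc_sum {W I : Type*} [AddCommGroup W] [Module k W] [Fintype I]
    (F : W ⊗[k] W →ₗ[k] k) (a : W) (e : I → W) :
    TensorProduct.rid k W (TensorProduct.map LinearMap.id F
      (TensorProduct.assoc k W W W ((∑ i, e i ⊗ₜ e i) ⊗ₜ a))) =
      ∑ i, F (e i ⊗ₜ a) • e i := by
  simp only [sum_tmul, map_sum, TensorProduct.assoc_tmul, map_tmul, TensorProduct.rid_tmul,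
    LinearMap.id_apply]

/-- Since `ε(a p_x) = a(x)`, both zigzag identities become the expansion of `a` in the basis of the
`p_x`. -/
theorem funAlg_isSeparable : IsSeparable (funAlg k H) := by
  classical
  have h1 : ∀ a : G ⧸ H → k, ∑ x, a x • (Pi.single x 1 : G ⧸ H → k) = a := fun a => by
    ext y; simp [Finset.sum_apply, Pi.single_apply]
  refine ⟨sumForm k H, copairing k H, hom_ext _ _ (LinearMap.ext fun a => ?_),
    hom_ext _ _ (LinearMap.ext fun a => ?_)⟩
  · change TensorProduct.lid k _ (TensorProduct.map
      ((sumForm k H).hom ∘ₗ LinearMap.mul' k (G ⧸ H → k)) LinearMap.id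
      ((TensorProduct.assoc k _ _ _).symm (a ⊗ₜ ((1 : k) • casimir k H)))) = a
    rw [one_smul]
    refine (lid_map_assoc_symm_sum k _ a _).trans ((Finset.sum_congr rfl fun x _ => ?_).trans (h1 a))
    congr 1
    refine (sumForm_hom k H (a * Pi.single x 1)).trans ?_
    simp [Pi.single_apply]
  · change TensorProduct.rid k _ (TensorProduct.map LinearMap.id
      ((sumForm k H).hom ∘ₗ LinearMap.mul' k (G ⧸ H → k))
      (TensorProduct.assoc k _ _ _ (((1 : k) • casimir k H) ⊗ₜ a))) = a
    rw [one_smul]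
    refine (rid_map_assoc_sum k _ a _).trans ((Finset.sum_congr rfl fun x _ => ?_).trans (h1 a))
    congr 1
    refine (sumForm_hom k H (Pi.single x 1 * a)).trans ?_
    simp [Pi.single_apply]

end Separable

/-! ### Elements of the relative tensor product. -/

section TensorElements

variable {k : Type u} [Field k] {G : Type u} [Group G] [Finite G] {H : Subgroup G}

theorem ZCat.coeqπ_condition {X Y : ZCat k G} (f g : X ⟶ Y) : f ≫ coeqπ f g = g ≫ coeqπ f g := by
  refine hom_ext _ _ (LinearMap.ext fun x => ?_)
  change Submodule.Quotient.mk (f.hom x) = Submodule.Quotient.mk (g.hom x)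
  rw [Submodule.Quotient.eq]
  exact ⟨x, rfl⟩

/-- The projection onto the cokernel, built as the coequalizer of `f` and `0`, is killed by `f`. It
is therefore zero when `f` is epi, so the range of `f` is everything. This gives access to elements
of `M ⊗_A N`, which is defined only by a universal property. -/
theorem ZCat.surjective_of_epi {X Y : ZCat k G} (f : X ⟶ Y) [Epi f] :
    Function.Surjective f.hom := by
  have h : coeqπ f 0 = 0 := by
    rw [← cancel_epi f, comp_zero]
    refine hom_ext _ _ (LinearMap.ext fun x => ?_)
    change Submodule.Quotient.mk (f.hom x) = _
    exact (Submodule.Quotient.mk_eq_zero _).2 ⟨x, by simp⟩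
  intro y
  have hy : (Submodule.mkQ _) y = 0 := LinearMap.congr_fun (congrArg Hom.hom h) y
  obtain ⟨x, hx⟩ := (Submodule.Quotient.mk_eq_zero _).1 hy
  exact ⟨x, by simpa using hx⟩

namespace RMod

/-- The canonical linear map `M ⊗ N → M ⊗_A N`. -/
noncomputable def mkTensor (M N : RMod (funAlg k H)) :
    M.X.V ⊗[k] N.X.V →ₗ[k] (M ⊗ N : RMod (funAlg k H)).X.V :=
  (proj M N).hom

theorem mkTensor_surjective (M N : RMod (funAlg k H)) : Function.Surjective (mkTensor M N) :=
  surjective_of_epi (proj M N)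

theorem mkTensor_rmul (M N : RMod (funAlg k H)) (a : G ⧸ H → k) (m : M.X.V) (n : N.X.V) :
    mkTensor M N (rmul M a m ⊗ₜ n) = mkTensor M N (m ⊗ₜ rmul N a n) := by
  have h := LinearMap.congr_fun (congrArg ZCat.Hom.hom (π_condition M N)) ((m ⊗ₜ a) ⊗ₜ n)
  change mkTensor M N (rmul M a m ⊗ₜ n) =
    mkTensor M N (m ⊗ₜ N.act.hom (braidMap (funAlg k H) N.X (a ⊗ₜ n))) at h
  -- The algebra sits in degree `1`, so its braiding past `N` is the plain flip.
  rw [braidMap_tmul _ (funAlg_mem _), map_one] at h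
  exact h

theorem rmul_mkTensor (M N : RMod (funAlg k H)) (a : G ⧸ H → k) (m : M.X.V) (n : N.X.V) :
    rmul (M ⊗ N) a (mkTensor M N (m ⊗ₜ n)) = mkTensor M N (m ⊗ₜ rmul N a n) :=
  LinearMap.congr_fun (congrArg ZCat.Hom.hom (π_act M N)) ((m ⊗ₜ n) ⊗ₜ a)

theorem ρ_mkTensor (M N : RMod (funAlg k H)) (g : G) (m : M.X.V) (n : N.X.V) :
    (M ⊗ N : RMod (funAlg k H)).X.ρ g (mkTensor M N (m ⊗ₜ n)) =
      mkTensor M N (M.X.ρ g m ⊗ₜ N.X.ρ g n) :=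
  ((proj M N).comm_ρ g (m ⊗ₜ n)).symm

theorem mkTensor_mem (M N : RMod (funAlg k H)) {g h : G} {m : M.X.V} {n : N.X.V}
    (hm : m ∈ M.X.grade g) (hn : n ∈ N.X.grade h) :
    mkTensor M N (m ⊗ₜ n) ∈ (M ⊗ N : RMod (funAlg k H)).X.grade (g * h) :=
  hom_mem (proj M N) (tmul_mem hm hn)

/-- Balanced linear maps factor through the tensor product of modules. -/
theorem exists_lift_mkTensor (M N : RMod (funAlg k H)) {W : Type*} [AddCommGroup W] [Module k W]
    (T : M.X.V ⊗[k] N.X.V →ₗ[k] W)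
    (hT : ∀ a m n, T (rmul M a m ⊗ₜ n) = T (m ⊗ₜ rmul N a n)) :
    ∃ L : (M ⊗ N : RMod (funAlg k H)).X.V →ₗ[k] W, ∀ t, L (mkTensor M N t) = T t := by
  -- `T` is merely linear, so the universal property in `𝒵(G)` does not apply to it. It is applied
  -- instead to the projection onto the explicit quotient `coeq f g`, through which a linear `T`
  -- factors.
  let f := M.act ▷ N.X
  let g := (α_ M.X (funAlg k H) N.X).hom ≫ M.X ◁ ((β_ (funAlg k H) N.X).hom ≫ N.act)
  have hc := coeqπ_condition f g
  have hT' : T ∘ₗ f.hom = T ∘ₗ g.hom := by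
    refine TensorProduct.ext (TensorProduct.ext' fun m a => LinearMap.ext fun n => ?_)
    refine (hT a m n).trans ?_
    change _ = T (m ⊗ₜ N.act.hom (braidMap (funAlg k H) N.X (a ⊗ₜ n)))
    rw [braidMap_tmul _ (funAlg_mem _), map_one]
    rfl
  have hker : LinearMap.range (f.hom - g.hom) ≤ LinearMap.ker T := by
    rintro _ ⟨x, rfl⟩
    rw [LinearMap.mem_ker, LinearMap.sub_apply, map_sub]
    exact sub_eq_zero.2 (LinearMap.congr_fun hT' x)
  refine ⟨Submodule.liftQ _ T hker ∘ₗ (desc (coeqπ f g) hc).hom, fun t => ?_⟩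
  have h := LinearMap.congr_fun (congrArg ZCat.Hom.hom (π_desc (coeqπ f g) hc)) t
  exact congrArg (Submodule.liftQ _ T hker) h

end RMod

end TensorElements

/-! ### The equivalence of underlying categories. -/

section Equivalence

variable {k : Type u} [Field k] {G : Type u} [Group G] [Finite G] {H : Subgroup G}

/-- The linear map `p_g ⊗ u ↦ g u` if `g ∈ H`, and `p_g ⊗ u ↦ 0` otherwise. -/
noncomputable def indEval (U : ZCat k H) : IndV U →ₗ[k] U.V :=
  (indRel U).liftQ (∑ h : H, (TensorProduct.lid k U.V).toLinearMap ∘ₗ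
      TensorProduct.map (LinearMap.proj (h : G)) (U.ρ h))
    (indRel_le_ker _ fun g a u => by
      simp only [LinearMap.sum_apply, LinearMap.comp_apply, map_tmul, LinearMap.proj_apply,
        LinearEquiv.coe_coe, TensorProduct.lid_tmul]
      -- The substitution `h ↦ ha` matches the two sums, because `p_{ga}` at `ha` equals `p_g` at
      -- `h`.
      refine (Fintype.sum_equiv (Equiv.mulRight a) _ _ fun h => ?_).symm
      rw [Equiv.coe_mulRight, ρ_mul]
      congr 1
      classical
      simp [delta, Pi.single_apply])

theorem indEval_mk (U : ZCat k H) (g : G) (u : U.V) :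
    indEval U (indMk U g u) = ∑ h : H, delta k g (h : G) • U.ρ h u := by
  change (∑ h : H, (TensorProduct.lid k U.V).toLinearMap ∘ₗ
      TensorProduct.map (LinearMap.proj (h : G)) (U.ρ h)) (delta k g ⊗ₜ u) = _
  simp only [LinearMap.sum_apply, LinearMap.comp_apply, map_tmul, LinearMap.proj_apply,
    LinearEquiv.coe_coe, TensorProduct.lid_tmul]

theorem indEval_mk_one (U : ZCat k H) (u : U.V) : indEval U (indMk U 1 u) = u := by
  classical
  rw [indEval_mk, Finset.sum_eq_single 1]
  · simp [delta]
  · intro h _ hh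
    have : (h : G) ≠ 1 := fun e => hh (Subtype.ext e)
    simp [delta, this]
  · simp

theorem indMk_of_mem (U : ZCat k H) (h : H) (u : U.V) : indMk U h u = indMk U 1 (U.ρ h u) := by
  rw [← indMk_mul, _root_.one_mul]

/-- The linear map `u ↦ p_g ⊗ u`. -/
noncomputable def indMkₗ (U : ZCat k H) (g : G) : U.V →ₗ[k] IndV U :=
  (indRel U).mkQ ∘ₗ TensorProduct.mk k _ _ (delta k g)

theorem indMkₗ_apply (U : ZCat k H) (g : G) (u : U.V) : indMkₗ U g u = indMk U g u := rfl

theorem rmul_indMk (U : ZCat k H) (a : G ⧸ H → k) (g : G) (u : U.V) :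
    (indMod U).rmul a (indMk U g u) = a (g : G ⧸ H) • indMk U g u :=
  indMul_mk U a g u

theorem indMk_mem (U : ZCat k H) (g : G) {h : H} {u : U.V} (hu : u ∈ U.grade h) :
    indMk U g u ∈ (indZ U).grade (g * h * g⁻¹) := by
  classical
  rw [mem_grade]
  exact (indPr_mk U _ g hu).trans (if_pos rfl)

theorem idem_apply_of_mem {g : G} (hg : g ∈ H) : idem k H (g : G ⧸ H) = 1 := by
  classical
  rw [idem, Pi.single_apply, if_pos]
  rw [QuotientGroup.eq]; simpa using hg

theorem idem_apply_of_notMem {g : G} (hg : g ∉ H) : idem k H (g : G ⧸ H) = 0 := by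
  classical
  rw [idem, Pi.single_apply, if_neg]
  rw [QuotientGroup.eq]; simpa using hg

/-- On `k(G) ⊗_H U`, multiplication by the idempotent `p` is the projection onto `p_1 ⊗ U`. -/
theorem rmul_idem_ind (U : ZCat k H) (w : IndV U) :
    (indMod U).rmul (idem k H) w = indMk U 1 (indEval U w) := by
  refine LinearMap.congr_fun (f := (indMod U).rmul (idem k H)) (g := indMkₗ U 1 ∘ₗ indEval U)
    (ind_ext fun g b u _ => ?_) w
  refine (rmul_indMk U (idem k H) g u).trans ?_
  change _ = indMk U 1 (indEval U (indMk U g u))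
  -- For `g ∈ H` the relations give `p_g ⊗ u = p_1 ⊗ gu`, which `p` fixes. Otherwise `p` kills `p_g
  -- ⊗ u`, and no term of `indEval` survives.
  by_cases hg : g ∈ H
  · rw [idem_apply_of_mem hg, one_smul, indMk_of_mem U ⟨g, hg⟩, indEval_mk_one]
  · rw [idem_apply_of_notMem hg, zero_smul, indEval_mk, Finset.sum_eq_zero, ← indMkₗ_apply,
      map_zero]
    rintro h -
    have : (h : G) ≠ g := fun e => hg (e ▸ h.2)
    classical
    simp [delta, this]

/-- As `p² = p`, lying in `Mp` amounts to being fixed by `p`; this is how elements of a corner are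
used throughout. -/
theorem rmul_idem_self (M : RMod (funAlg k H)) (v : LinearMap.range (M.rmul (idem k H))) :
    M.rmul (idem k H) v = v := by
  obtain ⟨_, m, rfl⟩ := v
  rw [RMod.rmul_rmul, idem_mul_idem]

/-- The linear isomorphism `(k(G) ⊗_H U) p ≃ U`. -/
noncomputable def cornerIndEquiv (U : ZCat k H) :
    LinearMap.range ((indMod U).rmul (idem k H)) ≃ₗ[k] U.V where
  __ := indEval U ∘ₗ Submodule.subtype _
  -- The preimage witnessing membership in the range is the element itself, since `p` fixes `p_1 ⊗
  -- u`.
  invFun u := ⟨indMk U 1 u, indMk U 1 u, by rw [rmul_idem_ind, indEval_mk_one]⟩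
  left_inv v := Subtype.ext ((rmul_idem_ind U _).symm.trans (rmul_idem_self _ v))
  right_inv u := indEval_mk_one U u

theorem mem_cornerObj {M : LocMod (funAlg k H)} {h : H} {v : (cornerObj M).V} :
    v ∈ (cornerObj M).grade h ↔ (v : M.obj.X.V) ∈ M.obj.X.grade (h : G) := by
  rw [mem_grade, mem_grade]
  exact Subtype.ext_iff

/-- Built as the inverse of `u ↦ p_1 ⊗ u`, since the action and the grading are explicit on the
elements `p_1 ⊗ u`. -/
noncomputable def cornerIndIso (U : ZCat k H) :
    (cornerFunctor k H).obj ((indFunctor k H).obj U) ≅ U :=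
  (ZCat.isoMk (X := U) (Y := cornerObj ⟨indMod U, indMod_isLocal U⟩) (cornerIndEquiv U).symm
    (fun h u => Subtype.ext (by
      change indMk U 1 (U.ρ h u) = indρ U h (indMk U 1 u)
      rw [indρ_mk, _root_.mul_one, indMk_of_mem]))
    (comm_of_mem (X := U) (Y := cornerObj ⟨indMod U, indMod_isLocal U⟩)
      (T := (cornerIndEquiv U).symm.toLinearMap) fun h u hu => by
        rw [mem_cornerObj]
        have := indMk_mem U 1 hu
        rwa [_root_.one_mul, inv_one, _root_.mul_one] at this)).symm

variable (k H) in
noncomputable def cornerIndNatIso : indFunctor k H ⋙ cornerFunctor k H ≅ 𝟭 (ZCat k H) :=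
  NatIso.ofComponents cornerIndIso fun {U W} f => by
    -- Naturality is moved to the inverse isomorphisms `u ↦ p_1 ⊗ u`, where it is immediate.
    rw [← Iso.eq_comp_inv, Category.assoc, ← Iso.inv_comp_eq]
    refine hom_ext _ _ (LinearMap.ext fun u => Subtype.ext ?_)
    exact indMap_mk f 1 u

/-- The linear map `k(G) ⊗_H M p → M`, `p_g ⊗ v ↦ g v`. -/
noncomputable def indCornerMap (M : LocMod (funAlg k H)) : IndV (cornerObj M) →ₗ[k] M.obj.X.V :=
  (indRel (cornerObj M)).liftQ (∑ g : G, (TensorProduct.lid k M.obj.X.V).toLinearMap ∘ₗ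
      TensorProduct.map (LinearMap.proj g) (M.obj.X.ρ g ∘ₗ Submodule.subtype _))
    (indRel_le_ker _ fun g a u => by
      simp only [LinearMap.sum_apply, LinearMap.comp_apply, map_tmul, LinearMap.proj_apply,
        LinearEquiv.coe_coe, TensorProduct.lid_tmul]
      refine (Fintype.sum_equiv (Equiv.mulRight (a : G)) _ _ fun h => ?_).symm
      rw [Equiv.coe_mulRight, ρ_mul]
      congr 1
      classical
      simp [delta, Pi.single_apply])

theorem indCornerMap_mk (M : LocMod (funAlg k H)) (g : G) (u : (cornerObj M).V) :
    indCornerMap M (indMk (cornerObj M) g u) = M.obj.X.ρ g (u : M.obj.X.V) := by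
  classical
  change (∑ g : G, (TensorProduct.lid k M.obj.X.V).toLinearMap ∘ₗ
      TensorProduct.map (LinearMap.proj g) (M.obj.X.ρ g ∘ₗ Submodule.subtype _))
        (delta k g ⊗ₜ u) = _
  simp only [LinearMap.sum_apply, LinearMap.comp_apply, map_tmul, LinearMap.proj_apply,
    LinearEquiv.coe_coe, TensorProduct.lid_tmul]
  rw [Finset.sum_eq_single g]
  · simp [delta]
  · intro h _ hh
    simp [delta, hh]
  · simp

/-- The projection `m ↦ m p` onto the corner. -/
noncomputable def toCorner (M : LocMod (funAlg k H)) : M.obj.X.V →ₗ[k] (cornerObj M).V :=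
  (M.obj.rmul (idem k H)).rangeRestrict

theorem coe_toCorner (M : LocMod (funAlg k H)) (m : M.obj.X.V) :
    (toCorner M m : M.obj.X.V) = M.obj.rmul (idem k H) m := rfl

theorem toCorner_coe (M : LocMod (funAlg k H)) (v : (cornerObj M).V) :
    toCorner M (v : M.obj.X.V) = v := Subtype.ext (rmul_idem_self _ v)

/-- Here `gv = g(vp) = (gv)(gp)`, and `gp` is the delta function at a coset other than `H`, hence
orthogonal to `p`. -/
theorem toCorner_ρ_of_notMem (M : LocMod (funAlg k H)) {g : G} (hg : g ∉ H)
    (v : (cornerObj M).V) : toCorner M (M.obj.X.ρ g (v : M.obj.X.V)) = 0 := by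
  refine Subtype.ext ?_
  rw [coe_toCorner]
  conv_lhs => rw [← rmul_idem_self M.obj v]
  rw [RMod.ρ_rmul, RMod.rmul_rmul, _root_.mul_comm, idem_mul_of_notMem hg, RMod.rmul_zero]
  rfl

/-- The inverse `m ↦ ∑ x, p_x ⊗ (x⁻¹ m) p` of `indCornerMap`, the sum being over
representatives of the cosets. -/
noncomputable def indCornerInv (M : LocMod (funAlg k H)) : M.obj.X.V →ₗ[k] IndV (cornerObj M) :=
  ∑ x : G ⧸ H, indMkₗ (cornerObj M) x.out ∘ₗ toCorner M ∘ₗ M.obj.X.ρ x.out⁻¹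

theorem indCornerInv_apply (M : LocMod (funAlg k H)) (m : M.obj.X.V) :
    indCornerInv M m =
      ∑ x : G ⧸ H, indMk (cornerObj M) x.out (toCorner M (M.obj.X.ρ x.out⁻¹ m)) := by
  rw [indCornerInv, LinearMap.sum_apply]
  rfl

theorem RMod.rmul_sum (M : RMod (funAlg k H)) {I : Type*} [Fintype I] (a : I → G ⧸ H → k)
    (m : M.X.V) : M.rmul (∑ i, a i) m = ∑ i, M.rmul (a i) m := by
  simp only [RMod.rmul_apply, tmul_sum, map_sum]

theorem RMod.rmul_smul (M : RMod (funAlg k H)) (r : k) (a : G ⧸ H → k)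
    (m : M.X.V) : M.rmul (r • a) m = r • M.rmul a m := by
  simp only [RMod.rmul_apply, tmul_smul, map_smul]

theorem RMod.rmul_one (M : RMod (funAlg k H)) (m : M.X.V) : M.rmul 1 m = m := by
  have h := LinearMap.congr_fun (congrArg ZCat.Hom.hom M.act_one) (m ⊗ₜ (1 : k))
  refine (congrArg (fun a => M.rmul a m) (map_one (algebraMap k (G ⧸ H → k))).symm).trans
    (h.trans ?_)
  exact one_smul k m

/-- The term of the coset `x`, with representative `r`, is `r((r⁻¹m)p) = m(rp) = m p_x`, and the
`p_x` sum to `1`. -/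
theorem indCornerMap_inv (M : LocMod (funAlg k H)) (m : M.obj.X.V) :
    indCornerMap M (indCornerInv M m) = m := by
  classical
  rw [indCornerInv_apply, map_sum]
  have h : ∀ x : G ⧸ H, indCornerMap M (indMk (cornerObj M) x.out
      (toCorner M (M.obj.X.ρ x.out⁻¹ m))) = M.obj.rmul (Pi.single x 1) m := fun x => by
    rw [indCornerMap_mk, coe_toCorner, RMod.ρ_rmul, ρ_ρ_inv, idem, funRep_single]
    congr 2
    simp
  rw [Finset.sum_congr rfl fun x _ => h x, ← RMod.rmul_sum]
  refine (congrArg (fun a => M.obj.rmul a m) ?_).trans (RMod.rmul_one M.obj m)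
  ext y
  simp [Finset.sum_apply, Pi.single_apply]

/-- On `p_g ⊗ u` only the coset `x = gH` contributes, by orthogonality. Its representative `r`
differs from `g` by `r⁻¹g ∈ H`, which the defining relation moves across the tensor sign. -/
theorem indCornerInv_map (M : LocMod (funAlg k H)) :
    indCornerInv M ∘ₗ indCornerMap M = LinearMap.id := by
  refine ind_ext fun g b u _ => ?_
  rw [LinearMap.comp_apply, indCornerMap_mk, indCornerInv_apply,
    Finset.sum_eq_single (g : G ⧸ H)]
  · rw [← ρ_mul]
    have hm : (g : G ⧸ H).out⁻¹ * g ∈ H := by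
      rw [← QuotientGroup.eq]; simp
    -- An element of `H` preserves the corner, so the projection onto it does nothing here.
    have h1 : toCorner M (M.obj.X.ρ ((g : G ⧸ H).out⁻¹ * g) (u : M.obj.X.V)) =
      (cornerObj M).ρ ⟨_, hm⟩ u := toCorner_coe M ((cornerObj M).ρ ⟨_, hm⟩ u)
    rw [h1, ← indMk_mul, mul_inv_cancel_left]
    rfl
  · intro x _ hx
    rw [← ρ_mul, toCorner_ρ_of_notMem, ← indMkₗ_apply, map_zero]
    rw [← QuotientGroup.eq]
    simpa using hx
  · simp

noncomputable def indCornerEquiv (M : LocMod (funAlg k H)) :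
    IndV (cornerObj M) ≃ₗ[k] M.obj.X.V :=
  LinearEquiv.ofLinearMap (indCornerMap M) (indCornerInv M)
    (LinearMap.ext (indCornerMap_inv M)) (indCornerInv_map M)

noncomputable def indCornerZIso (M : LocMod (funAlg k H)) : indZ (cornerObj M) ≅ M.obj.X :=
  ZCat.isoMk (X := indZ (cornerObj M)) (indCornerEquiv M)
    (fun f v => LinearMap.congr_fun (f := indCornerMap M ∘ₗ indρ (cornerObj M) f)
      (g := M.obj.X.ρ f ∘ₗ indCornerMap M) (ind_ext fun g b u _ => by
        rw [LinearMap.comp_apply, LinearMap.comp_apply, indρ_mk, indCornerMap_mk,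
          indCornerMap_mk, ρ_mul]) v)
    (fun f v => LinearMap.congr_fun (f := indCornerMap M ∘ₗ indPr (cornerObj M) f)
      (g := M.obj.X.pr f ∘ₗ indCornerMap M) (ind_ext fun g b u hu => by
        classical
        rw [LinearMap.comp_apply, LinearMap.comp_apply, indPr_mk _ f g hu, indCornerMap_mk,
          pr_of_mem (ρ_mem (mem_cornerObj.1 hu) g)]
        by_cases h : g * b * g⁻¹ = f
        · rw [if_pos h, if_pos h.symm, indCornerMap_mk]
        · rw [if_neg h, if_neg (Ne.symm h), map_zero]) v)

/-- This is the minimality of `p`: `Ap` is a line, so `A` acts on corners through evaluation at the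
trivial coset. -/
theorem mul_idem (a : G ⧸ H → k) : idem k H * a = a ((1 : G) : G ⧸ H) • idem k H := by
  classical
  ext x
  simp only [idem, Pi.mul_apply, Pi.smul_apply, Pi.single_apply]
  split_ifs with h
  · subst h; simp
  · simp

/-- Translating back, `(gv)a = g(v · g⁻¹a)`, and `g⁻¹a` acts on the corner by its value `a(gH)` at
the trivial coset. This is the `A`-linearity of `indCornerMap`. -/
theorem rmul_ρ_coe (M : LocMod (funAlg k H)) (g : G) (v : (cornerObj M).V) (a : G ⧸ H → k) :
    M.obj.rmul a (M.obj.X.ρ g (v : M.obj.X.V)) =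
      a (g : G ⧸ H) • M.obj.X.ρ g (v : M.obj.X.V) := by
  have ha : a = funRep k H g (funRep k H g⁻¹ a) := by
    ext x; simp
  conv_lhs => rw [ha, ← RMod.ρ_rmul, ← rmul_idem_self M.obj v, RMod.rmul_rmul, mul_idem,
    RMod.rmul_smul, rmul_idem_self, map_smul, funRep_apply]
  simp

noncomputable def indCornerIso (M : LocMod (funAlg k H)) :
    (indFunctor k H).obj ((cornerFunctor k H).obj M) ≅ M :=
  (RMod.IsLocal (A := funAlg k H)).isoMk (RMod.isoMk (M := indMod (cornerObj M)) (N := M.obj)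
    (indCornerZIso M) (hom_ext _ _ (TensorProduct.ext (ind_ext fun g b u _ =>
      LinearMap.ext fun a => by
        change indCornerMap M (indMul _ a (indMk _ g u)) =
          M.obj.rmul a (indCornerMap M (indMk (cornerObj M) g u))
        rw [indMul_mk, map_smul, indCornerMap_mk, rmul_ρ_coe]))))

variable (k H) in
noncomputable def indCornerNatIso :
    cornerFunctor k H ⋙ indFunctor k H ≅ 𝟭 (LocMod (funAlg k H)) :=
  NatIso.ofComponents indCornerIso fun {M N} f =>
    ObjectProperty.hom_ext _ (RMod.hom_ext _ _ (hom_ext _ _ (ind_ext fun g b u _ => by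
      refine ((congrArg (indCornerMap N) (indMap_mk ((cornerFunctor k H).map f) g u)).trans
        (indCornerMap_mk N g _)).trans (Eq.trans ?_
          (congrArg f.hom.hom.hom (indCornerMap_mk M g u)).symm)
      -- On `p_g ⊗ u`, naturality is the `G`-equivariance of `f`.
      exact (f.hom.hom.comm_ρ g _).symm)))

variable (k H) in
/-- The equivalence between local `k(G/H)`-modules and `𝒵(H)`. -/
noncomputable def cornerEquivalence : LocMod (funAlg k H) ≌ ZCat k H :=
  -- The unit is adjusted to satisfy the triangle identity, while both functors stay definitionally
  -- as given.
  .mk (cornerFunctor k H) (indFunctor k H) (indCornerNatIso k H).symm (cornerIndNatIso k H)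

end Equivalence

/-! ### The monoidal and braided structure of `M ↦ Mp`. -/

section Monoidal

variable {k : Type u} [Field k] {G : Type u} [Group G] [Finite G] {H : Subgroup G}

/-- The linear map `M p ⊗ N p → (M ⊗_A N) p`. -/
noncomputable def cornerMul (M N : LocMod (funAlg k H)) :
    (cornerObj M).V ⊗[k] (cornerObj N).V →ₗ[k] (cornerObj (M ⊗ N)).V :=
  toCorner (M ⊗ N) ∘ₗ RMod.mkTensor M.obj N.obj ∘ₗ
    TensorProduct.map (Submodule.subtype _) (Submodule.subtype _)

/-- The final projection in `cornerMul` is invisible: `p` acts on `M ⊗_A N` through the second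
factor, and it fixes `v`. -/
theorem coe_cornerMul (M N : LocMod (funAlg k H)) (u : (cornerObj M).V) (v : (cornerObj N).V) :
    (cornerMul M N (u ⊗ₜ v)).1 =
      RMod.mkTensor M.obj N.obj ((u : M.obj.X.V) ⊗ₜ[k] (v : N.obj.X.V)) :=
  (RMod.rmul_mkTensor M.obj N.obj (idem k H) (u : M.obj.X.V) (v : N.obj.X.V)).trans
    (by rw [rmul_idem_self])

/-- By idempotence and balancing, `(m ⊗ n)p = m ⊗ np = m ⊗ (np)p = mp ⊗ np`. -/
theorem toCorner_mkTensor (M N : LocMod (funAlg k H)) (t : M.obj.X.V ⊗[k] N.obj.X.V) :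
    toCorner (M ⊗ N) (RMod.mkTensor M.obj N.obj t) =
      cornerMul M N (TensorProduct.map (toCorner M) (toCorner N) t) := by
  refine LinearMap.congr_fun (f := toCorner (M ⊗ N) ∘ₗ RMod.mkTensor M.obj N.obj)
    (g := cornerMul M N ∘ₗ TensorProduct.map (toCorner M) (toCorner N))
    (TensorProduct.ext' fun m n => Subtype.ext ?_) t
  refine (RMod.rmul_mkTensor M.obj N.obj (idem k H) m n).trans ?_
  refine Eq.trans ?_ (coe_cornerMul M N (toCorner M m) (toCorner N n)).symm
  rw [coe_toCorner, coe_toCorner, RMod.mkTensor_rmul, RMod.rmul_rmul, idem_mul_idem]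

/-- Since scalars can be moved across `⊗` over `k`, this makes `m ⊗ n ↦ mp ⊗ np` balanced over `A`.
-/
theorem toCorner_rmul (M : LocMod (funAlg k H)) (a : G ⧸ H → k) (m : M.obj.X.V) :
    toCorner M (M.obj.rmul a m) = a ((1 : G) : G ⧸ H) • toCorner M m := by
  refine Subtype.ext ?_
  rw [coe_toCorner, RMod.rmul_rmul, _root_.mul_comm, mul_idem, RMod.rmul_smul]
  rfl

/-- The balanced map `m ⊗ n ↦ mp ⊗ np` descends to `M ⊗_A N` and is a left inverse of `cornerMul`,
which gives injectivity. Surjectivity holds because every element of `M ⊗_A N` comes from some `t ∈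
M ⊗ N`, and projecting it to the corner replaces `t` by its image in `Mp ⊗ Np`. -/
theorem cornerMul_bijective (M N : LocMod (funAlg k H)) : Function.Bijective (cornerMul M N) := by
  constructor
  · obtain ⟨L, hL⟩ := RMod.exists_lift_mkTensor M.obj N.obj
      (TensorProduct.map (toCorner M) (toCorner N)) fun a m n => by
        rw [map_tmul, map_tmul, toCorner_rmul, toCorner_rmul, smul_tmul]
    have h : L ∘ₗ Submodule.subtype _ ∘ₗ cornerMul M N = LinearMap.id :=
      TensorProduct.ext' fun u v => by
        refine (congrArg L (coe_cornerMul M N u v)).trans ((hL _).trans ?_)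
        rw [map_tmul, toCorner_coe, toCorner_coe]
        rfl
    exact Function.LeftInverse.injective (g := fun x => L (Submodule.subtype _ x))
      (LinearMap.congr_fun h)
  · intro x
    obtain ⟨t, ht⟩ := RMod.mkTensor_surjective M.obj N.obj x.1
    exact ⟨TensorProduct.map (toCorner M) (toCorner N) t,
      (toCorner_mkTensor M N t).symm.trans ((congrArg (toCorner (M ⊗ N)) ht).trans
        (toCorner_coe (M ⊗ N) x))⟩

/-- The isomorphism `M p ⊗ N p ≅ (M ⊗_A N) p`. -/
noncomputable def cornerMulIso (M N : LocMod (funAlg k H)) :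
    (cornerFunctor k H).obj M ⊗ (cornerFunctor k H).obj N ≅ (cornerFunctor k H).obj (M ⊗ N) :=
  ZCat.isoMk (X := ZCat.tensor (cornerObj M) (cornerObj N)) (Y := cornerObj (M ⊗ N))
    (LinearEquiv.ofBijective (cornerMul M N) (cornerMul_bijective M N))
    (fun h t => LinearMap.congr_fun
      (f := cornerMul M N ∘ₗ TensorProduct.map ((cornerObj M).ρ h) ((cornerObj N).ρ h))
      (g := (cornerObj (M ⊗ N)).ρ h ∘ₗ cornerMul M N) (TensorProduct.ext' fun u v =>
        Subtype.ext ((coe_cornerMul M N _ _).trans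
          ((RMod.ρ_mkTensor M.obj N.obj (h : G) (u : M.obj.X.V) (v : N.obj.X.V)).symm.trans
            (congrArg ((M ⊗ N).obj.X.ρ (h : G)) (coe_cornerMul M N u v).symm)))) t)
    (tensor_comm_pr (X := cornerObj M) (Y := cornerObj N) (Z := cornerObj (M ⊗ N))
      (T := cornerMul M N) fun a u hu b v hv => by
        rw [mem_cornerObj, coe_cornerMul]
        exact RMod.mkTensor_mem M.obj N.obj (mem_cornerObj.1 hu) (mem_cornerObj.1 hv))

theorem cornerMulIso_tmul (M N : LocMod (funAlg k H)) (u : (cornerObj M).V)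
    (v : (cornerObj N).V) :
    ((cornerMulIso M N).hom.hom (u ⊗ₜ v)).1 =
      RMod.mkTensor M.obj N.obj ((u : M.obj.X.V) ⊗ₜ[k] (v : N.obj.X.V)) :=
  coe_cornerMul M N u v

variable (k H) in
/-- The linear isomorphism `k ≃ A p`. -/
noncomputable def cornerUnitEquiv :
    k ≃ₗ[k] LinearMap.range ((RMod.unit (A := funAlg k H)).rmul (idem k H)) where
  toFun r := ⟨r • idem k H, r • idem k H, by
    change (r • idem k H) * idem k H = r • idem k H
    rw [smul_mul_assoc, idem_mul_idem]⟩
  map_add' r s := Subtype.ext (add_smul r s _)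
  map_smul' r s := Subtype.ext (mul_smul r s _)
  invFun v := (show G ⧸ H → k from v.1) ((1 : G) : G ⧸ H)
  left_inv r := by
    change r * idem k H ((1 : G) : G ⧸ H) = r
    rw [idem_apply_of_mem (one_mem H), _root_.mul_one]
  right_inv v := by
    refine Subtype.ext (Eq.trans ?_ (rmul_idem_self RMod.unit v))
    refine (mul_idem (H := H) (show G ⧸ H → k from v.1)).symm.trans ?_
    exact _root_.mul_comm _ _

variable (k H) in
-- The map `r ↦ rp` is equivariant because `H` stabilizes `p`.
noncomputable def cornerUnitIso :
    𝟙_ (ZCat k H) ≅ (cornerFunctor k H).obj (𝟙_ (LocMod (funAlg k H))) :=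
  ZCat.isoMk (X := ZCat.unit) (Y := cornerObj (𝟙_ (LocMod (funAlg k H)))) (cornerUnitEquiv k H)
    (fun h r => Subtype.ext (by
      change r • idem k H = funRep k H h (r • idem k H)
      rw [map_smul, funRep_idem_of_mem h.2]))
    (comm_of_mem (X := ZCat.unit) (Y := cornerObj (𝟙_ (LocMod (funAlg k H))))
      (T := (cornerUnitEquiv k H).toLinearMap) fun h r hr => by
        by_cases hh : h = 1
        · subst hh
          rw [mem_cornerObj]
          exact funAlg_mem _
        · rw [eq_zero_of_mem_unit hr hh, map_zero]
          exact Submodule.zero_mem _)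

/-- This and the next three lemmas evaluate the structure morphisms of modules on pure tensors, so
that coherence for the corner functor can be checked on elements. -/
theorem RMod.associator_mkTensor (L M N : RMod (funAlg k H)) (x : L.X.V) (y : M.X.V)
    (z : N.X.V) : (α_ L M N).hom.hom.hom (mkTensor (L ⊗ M) N (mkTensor L M (x ⊗ₜ y) ⊗ₜ z)) =
      mkTensor L (M ⊗ N) (x ⊗ₜ mkTensor M N (y ⊗ₜ z)) :=
  LinearMap.congr_fun (congrArg ZCat.Hom.hom (proj_associator L M N)) ((x ⊗ₜ y) ⊗ₜ z)

theorem RMod.leftUnitor_mkTensor (M : RMod (funAlg k H)) (a : G ⧸ H → k) (x : M.X.V) :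
    (λ_ M).hom.hom.hom (mkTensor (𝟙_ _) M (a ⊗ₜ x)) = M.rmul a x := by
  refine (LinearMap.congr_fun (congrArg ZCat.Hom.hom (proj_leftUnitor M)) (a ⊗ₜ x)).trans ?_
  change M.act.hom (braidMap (funAlg k H) M.X (a ⊗ₜ x)) = _
  rw [braidMap_tmul _ (funAlg_mem _), map_one]
  rfl

theorem RMod.rightUnitor_mkTensor (M : RMod (funAlg k H)) (a : G ⧸ H → k) (x : M.X.V) :
    (ρ_ M).hom.hom.hom (mkTensor M (𝟙_ _) (x ⊗ₜ a)) = M.rmul a x :=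
  LinearMap.congr_fun (congrArg ZCat.Hom.hom (proj_rightUnitor M)) (x ⊗ₜ a)

theorem RMod.braid_mkTensor (M N : RMod (funAlg k H)) (hM : IsLocal M) {g : G} {x : M.X.V}
    (hx : x ∈ M.X.grade g) (y : N.X.V) :
    (braid M N hM).hom.hom.hom (mkTensor M N (x ⊗ₜ y)) = mkTensor N M (N.X.ρ g y ⊗ₜ x) :=
  (LinearMap.congr_fun (congrArg ZCat.Hom.hom (proj_braid M N hM)) (x ⊗ₜ y)).trans
    (congrArg (mkTensor N M) (braidMap_tmul N.X hx y))

variable (k H) in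
-- By `cornerMulIso_tmul` the comparison map sends `u ⊗ v` to the class of `u ⊗ v` in `M ⊗_A N`.
-- Each axiom thus compares the values of two structure morphisms on the same pure tensors.
noncomputable def cornerCoreMonoidal : (cornerFunctor k H).CoreMonoidal where
  εIso := cornerUnitIso k H
  μIso := cornerMulIso
  μIso_hom_natural_left {M M'} f N := by
    refine hom_ext _ _ (TensorProduct.ext' fun u v => Subtype.ext ?_)
    refine (cornerMulIso_tmul M' N ((cornerFunctor k H).map f |>.hom u) v).trans ?_
    refine Eq.trans ?_ (congrArg (f ▷ N).hom.hom.hom (cornerMulIso_tmul M N u v)).symm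
    exact (LinearMap.congr_fun (congrArg ZCat.Hom.hom (RMod.proj_whiskerRight f.hom N.obj))
      (u.1 ⊗ₜ v.1)).symm
  μIso_hom_natural_right {N N'} M f := by
    refine hom_ext _ _ (TensorProduct.ext' fun u v => Subtype.ext ?_)
    refine (cornerMulIso_tmul M N' u ((cornerFunctor k H).map f |>.hom v)).trans ?_
    refine Eq.trans ?_ (congrArg (M ◁ f).hom.hom.hom (cornerMulIso_tmul M N u v)).symm
    exact (LinearMap.congr_fun (congrArg ZCat.Hom.hom (RMod.proj_whiskerLeft M.obj f.hom))
      (u.1 ⊗ₜ v.1)).symm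
  associativity L M N := by
    refine hom_ext _ _ (TensorProduct.ext_threefold fun u v w => Subtype.ext ?_)
    refine (congrArg (α_ L M N).hom.hom.hom.hom ((cornerMulIso_tmul (L ⊗ M) N
      ((cornerMulIso L M).hom.hom (u ⊗ₜ v)) w).trans (congrArg
        (fun t => RMod.mkTensor (L ⊗ M).obj N.obj (t ⊗ₜ w.1)) (cornerMulIso_tmul L M u v)))).trans ?_
    refine (RMod.associator_mkTensor L.obj M.obj N.obj u.1 v.1 w.1).trans ?_
    exact ((cornerMulIso_tmul L (M ⊗ N) u ((cornerMulIso M N).hom.hom (v ⊗ₜ w))).trans (congrArg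
        (fun t => RMod.mkTensor L.obj (M ⊗ N).obj (u.1 ⊗ₜ t)) (cornerMulIso_tmul M N v w))).symm
  left_unitality M := by
    refine hom_ext _ _ (TensorProduct.ext' fun (r : k) u => Subtype.ext ?_)
    refine Eq.trans ?_ (congrArg (λ_ M).hom.hom.hom.hom
      (cornerMulIso_tmul (𝟙_ _) M (cornerUnitEquiv k H r) u)).symm
    -- The unit comparison sends `r` to `rp`, and `u(rp) = ru` because `p` fixes `u`.
    refine Eq.trans ?_ (RMod.leftUnitor_mkTensor M.obj (r • idem k H) u.1).symm
    refine Eq.trans ?_ (RMod.rmul_smul M.obj r (idem k H) u.1).symm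
    exact (congrArg (fun x : M.obj.X.V => r • x) (rmul_idem_self M.obj u)).symm
  right_unitality M := by
    refine hom_ext _ _ (TensorProduct.ext' fun u (r : k) => Subtype.ext ?_)
    refine Eq.trans ?_ (congrArg (ρ_ M).hom.hom.hom.hom
      (cornerMulIso_tmul M (𝟙_ _) u (cornerUnitEquiv k H r))).symm
    refine Eq.trans ?_ (RMod.rightUnitor_mkTensor M.obj (r • idem k H) u.1).symm
    refine Eq.trans ?_ (RMod.rmul_smul M.obj r (idem k H) u.1).symm
    exact (congrArg (fun x : M.obj.X.V => r • x) (rmul_idem_self M.obj u)).symm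

noncomputable instance cornerMonoidal : (cornerFunctor k H).Monoidal :=
  (cornerCoreMonoidal k H).toMonoidal

/-- The degree and the action on a corner are those of the ambient module, so for `u` of degree `h ∈
H` both braidings send `u ⊗ v` to `hv ⊗ u`. -/
noncomputable instance cornerBraided : (cornerFunctor k H).Braided where
  braided M N := by
    refine hom_ext _ _ (TensorProduct.ext (ext_grade (X := cornerObj M) fun h u hu =>
      LinearMap.ext fun v => Subtype.ext ?_))
    refine (congrArg (β_ M N).hom.hom.hom.hom (cornerMulIso_tmul M N u v)).trans ?_
    refine (RMod.braid_mkTensor M.obj N.obj M.property (mem_cornerObj.1 hu) v.1).trans ?_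
    refine Eq.trans ?_ (congrArg (fun t => ((cornerMulIso N M).hom.hom t).1)
      (braidMap_tmul (cornerObj N) hu v)).symm
    exact (cornerMulIso_tmul N M ((cornerObj N).ρ h v) u).symm

end Monoidal

/-! ### Twist, duals and the ribbon structure on local modules. -/

section Ribbon

variable {k : Type u} [Field k] {G : Type u} [Group G] [Finite G] {H : Subgroup G}

/-- Morphisms into a right dual are determined by their pairing with the object. -/
theorem eq_of_whiskerRight_comp_evaluation {C : Type u₁} [Category.{v₁} C] [MonoidalCategory C]
    {X Y : C} [HasRightDual X] {f g : Y ⟶ Xᘁ} (h : f ▷ X ≫ ε_ X Xᘁ = g ▷ X ≫ ε_ X Xᘁ) :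
    f = g := by
  -- The duality adjunction turns the pairing of `f` with `X` back into `f`, up to a unitor.
  have := congrArg (tensorRightHomEquiv Y X Xᘁ (𝟙_ C)) h
  simpa using this

/-- The twist is self-adjoint for every pairing. -/
theorem ZCat.twistIso_pairing {U V : ZCat k G} (e : U ⊗ V ⟶ 𝟙_ (ZCat k G)) :
    (twistIso U).hom ▷ V ≫ e = U ◁ (twistIso V).hom ≫ e := by
  refine hom_ext _ _ (tensor_ext fun a x hx b y hy => ?_)
  change e.hom (twistMap U x ⊗ₜ y) = e.hom (x ⊗ₜ twistMap V y)
  rw [twistMap_of_mem hx, twistMap_of_mem hy]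
  -- If `ab = 1`, invariance of `e` under `a` gives `e(a⁻¹x ⊗ y) = e(x ⊗ ay)`, and `a = b⁻¹`.
  -- Otherwise both sides vanish for degree reasons.
  by_cases h : a * b = 1
  · have h' := e.comm_ρ a (U.ρ a⁻¹ x ⊗ₜ y)
    change e.hom (U.ρ a (U.ρ a⁻¹ x) ⊗ₜ V.ρ a y) = e.hom (U.ρ a⁻¹ x ⊗ₜ y) at h'
    rw [← h', ρ_ρ_inv, inv_eq_of_mul_eq_one_left h]
  · rw [eq_zero_of_mem_unit (hom_mem e (tmul_mem (ρ_inv_mem hx) hy)) h,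
      eq_zero_of_mem_unit (hom_mem e (tmul_mem hx (ρ_inv_mem hy))) h]

/-- The twist of the underlying object of a local module is a module homomorphism. -/
theorem act_twistIso (M : LocMod (funAlg k H)) :
    M.obj.act ≫ (twistIso M.obj.X).hom = (twistIso M.obj.X).hom ▷ funAlg k H ≫ M.obj.act := by
  refine hom_ext _ _ (TensorProduct.ext (ext_grade fun g m hm => LinearMap.ext fun a => ?_))
  change twistMap M.obj.X (M.obj.rmul a m) = M.obj.rmul a (twistMap M.obj.X m)
  -- Equivariance gives `g⁻¹(ma) = (g⁻¹m)(g⁻¹a)`. As `g⁻¹m` again has degree `g`, locality allows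
  -- `g⁻¹a` to be replaced by `g(g⁻¹a) = a`.
  rw [twistMap_of_mem hm, twistMap_of_mem (RMod.rmul_mem _ hm a), RMod.ρ_rmul,
    ← RMod.rmul_local M.property (ρ_inv_mem hm)]
  congr 2
  ext x
  simp

noncomputable def locTwistIso (M : LocMod (funAlg k H)) : M ≅ M :=
  (RMod.IsLocal (A := funAlg k H)).isoMk (RMod.isoMk (twistIso M.obj.X) (act_twistIso M))

theorem locTwistIso_natural {M N : LocMod (funAlg k H)} (f : M ⟶ N) :
    f ≫ (locTwistIso N).hom = (locTwistIso M).hom ≫ f :=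
  ObjectProperty.hom_ext _ (RMod.hom_ext _ _ (twistIso_natural f.hom.hom))

theorem RMod.proj_tensorHom {M M' N N' : RMod (funAlg k H)} (f : M ⟶ M') (g : N ⟶ N') :
    proj M N ≫ (f ⊗ₘ g).hom = (f.hom ⊗ₘ g.hom) ≫ proj M' N' := by
  rw [MonoidalCategory.tensorHom_def, RMod.comp_hom, ← Category.assoc, proj_whiskerRight, Category.assoc,
    proj_whiskerLeft, MonoidalCategory.tensorHom_def, Category.assoc]

/-- Both sides are induced along the epimorphism `M ⊗ N ⟶ M ⊗_A N` from the corresponding morphisms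
of `𝒵(G)`, where the identity is `twistIso_tensor`. -/
theorem locTwistIso_tensor (M N : LocMod (funAlg k H)) :
    (locTwistIso M).hom ⊗ₘ (locTwistIso N).hom =
      (β_ M N).hom ≫ (β_ N M).hom ≫ (locTwistIso (M ⊗ N)).hom := by
  refine ObjectProperty.hom_ext _ (RMod.hom_ext _ _ ?_)
  rw [← cancel_epi (RMod.proj M.obj N.obj)]
  refine (RMod.proj_tensorHom (locTwistIso M).hom.hom (locTwistIso N).hom.hom).trans ?_
  change ((twistIso M.obj.X).hom ⊗ₘ (twistIso N.obj.X).hom) ≫ RMod.proj M.obj N.obj =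
    RMod.proj M.obj N.obj ≫ (RMod.braid M.obj N.obj M.property).hom.hom ≫
      (RMod.braid N.obj M.obj N.property).hom.hom ≫ (twistIso (M.obj ⊗ N.obj).X).hom
  rw [reassoc_of% (RMod.proj_braid M.obj N.obj M.property),
    reassoc_of% (RMod.proj_braid N.obj M.obj N.property), twistIso_natural, twistIso_tensor]
  simp only [Category.assoc]

/-- On an element of degree `h ∈ H` both twists act by `h⁻¹`, since the action and the degree on
`Mp` are inherited from `M`. -/
theorem corner_map_locTwistIso (M : LocMod (funAlg k H)) :
    (cornerFunctor k H).map (locTwistIso M).hom = (twistIso ((cornerFunctor k H).obj M)).hom := by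
  refine hom_ext _ _ (ext_grade (X := cornerObj M) fun h v hv => Subtype.ext ?_)
  refine (twistMap_of_mem (mem_cornerObj.1 hv)).trans ?_
  exact (congrArg Subtype.val (twistMap_of_mem hv)).symm

instance cornerFunctor_isEquivalence : (cornerFunctor k H).IsEquivalence :=
  (cornerEquivalence k H).isEquivalence_functor

/-- The corner functor is faithful, monoidal and compatible with twists, so the statement follows
from `twistIso_pairing` in `𝒵(H)`. -/
theorem locTwistIso_pairing {M N : LocMod (funAlg k H)} (e : M ⊗ N ⟶ 𝟙_ (LocMod (funAlg k H))) :
    (locTwistIso M).hom ▷ N ≫ e = M ◁ (locTwistIso N).hom ≫ e := by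
  apply (cornerFunctor k H).map_injective
  -- Composing with the unit comparison makes the target the unit of `𝒵(H)`, as `twistIso_pairing`
  -- requires.
  rw [← cancel_mono (Functor.OplaxMonoidal.η (cornerFunctor k H))]
  simp only [Functor.map_comp, Functor.Monoidal.map_whiskerRight,
    Functor.Monoidal.map_whiskerLeft, corner_map_locTwistIso, Category.assoc]
  rw [twistIso_pairing]

variable (k H) in
-- This is the form in which the equivalence enters the transport of duals: a monoidal left adjoint
-- that is an equivalence, with rigid target.
noncomputable def cornerAdjunction : cornerFunctor k H ⊣ indFunctor k H :=
  (cornerEquivalence k H).toAdjunction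

variable (k H) in
/-- The rigid structure on local `k(G/H)`-modules transported from `𝒵(H)`. -/
noncomputable abbrev locRigid : RigidCategory (LocMod (funAlg k H)) :=
  rigidCategoryOfEquivalence (cornerAdjunction k H)

variable (k H) in
/-- The ribbon structure on local `k(G/H)`-modules. -/
noncomputable abbrev locRibbon : RibbonCategory (LocMod (funAlg k H)) where
  toRigidCategory := locRigid k H
  twist := NatIso.ofComponents locTwistIso locTwistIso_natural
  twist_tensor := locTwistIso_tensor
  twist_dual M := by
    let _ := locRigid k H
    -- Both morphisms into the dual are tested against evaluation. Self-adjointness moves the twist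
    -- from the dual to `M`, and what results is the defining property of the dual morphism.
    refine eq_of_whiskerRight_comp_evaluation ?_
    refine (locTwistIso_pairing _).trans ?_
    exact (rightAdjointMate_comp_evaluation (locTwistIso M).hom).symm

end Ribbon

end LocalModules

/-! ### Assembly of the ribbon equivalence. -/

theorem mainTheorem3 {k : Type u} [Field k] [IsAlgClosed k] [CharZero k]
    {G : Type u} [Group G] [Finite G] (H : Subgroup G) :
    IsSeparable (funAlg k H) ∧
    ∃ (_ : RibbonCategory (LocMod (funAlg k H))) (_ : (cornerFunctor k H).Braided)
      (e : LocMod (funAlg k H) ≌ ZCat k H),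
      (∀ M : LocMod (funAlg k H), (θ M).hom.hom = θ M.obj.X) ∧
      e.functor = cornerFunctor k H ∧
      e.inverse = indFunctor k H ∧
      (cornerFunctor k H).Additive ∧
      (cornerFunctor k H).Linear k ∧
      ∀ M : LocMod (funAlg k H), (cornerFunctor k H).map (θ M) = θ ((cornerFunctor k H).obj M) :=
  ⟨funAlg_isSeparable k H, locRibbon k H, cornerBraided, cornerEquivalence k H, fun _ => rfl,
    rfl, rfl, { map_add := rfl }, { map_smul := fun _ _ => rfl }, corner_map_locTwistIso⟩
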